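/- All graphs are finite, simple and undirected. For graphs $G,H$ let $G\bowtie H$ denote the graph obtained from the disjoint union of $G$ and $H$ by adding all edges between $V(G)$ and $V(H)$; let $C_n$, $P_n$ and $K_n$ denote the cycle, the path and the complete graph on $n$ vertices. A graph $G$ is $F$-subgraph-free if $G$ has no (not necessarily induced) subgraph isomorphic to $F$. An elimination forest of $G$ is a rooted forest $T$ with $V(T)=V(G)$ such that for every edge $uv$ of $G$ the vertices $u$ and $v$ lie on a common root-to-leaf path of $T$; the treedepth of $G$ is the minimum height of an elimination forest of $G$, where the height is the largest number of vertices on a root-to-leaf path. A class of graphs has bounded treedepth if there is a constant $c$ such that every graph in the class has treedepth at most $c$. **Theorem.** Let $F$ be a graph containing exactly one cycle. The class of $F$-subgraph-free graphs of diameter at most $2$ has bounded treedepth if and only if $F$ is bipartite, does not contain $C_4$ as a subgraph, and is a subgraph of $P_n\bowtie K_1$ for some $n\in\mathbb{N}$. -/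

import Mathlib

namespace SimpleGraph

/-- A rooted forest with vertex set `V`, given by its parent function: `parent v = none` means that
`v` is a root. Well-foundedness says that following parents always ends in a root (for finite `V`:
that there are no cycles). -/
structure RootedForest (V : Type*) where
  /-- The parent of a vertex, `none` for a root. -/
  parent : V → Option V
  wf : WellFounded (fun u v => parent v = some u)

namespace RootedForest

variable {V : Type*} (T : RootedForest V)

/-- `T.Ancestor u v`: the vertex `u` lies on the path from the root to `v` (possibly `u = v`). -/
def Ancestor (u v : V) : Prop :=
  Relation.ReflTransGen (fun a b => T.parent b = some a) u v

/-- The height of a rooted forest: the largest number of vertices on a path from a root to a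
vertex. -/
noncomputable def height : ℕ∞ :=
  ⨆ v : V, {u | T.Ancestor u v}.encard

/-- `T` is an elimination forest of `G`: it has the same vertices, and the two ends of every edge
of `G` lie on a common root-to-leaf path of `T`, that is, one is an ancestor of the other. -/
def IsEliminationForest (G : SimpleGraph V) : Prop :=
  ∀ ⦃u v : V⦄, G.Adj u v → T.Ancestor u v ∨ T.Ancestor v u

end RootedForest

/-- The treedepth of a graph: the minimum height of an elimination forest. -/
noncomputable def treedepth {V : Type*} (G : SimpleGraph V) : ℕ∞ :=
  ⨅ (T : RootedForest V) (_ : T.IsEliminationForest G), T.height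

/-- A class `C` of finite graphs has bounded treedepth. -/
def HasBoundedTreedepth (C : ∀ V : Type, SimpleGraph V → Prop) : Prop :=
  ∃ c : ℕ, ∀ (V : Type) [Finite V] (G : SimpleGraph V), C V G → G.treedepth ≤ c

/-- The join `G ⋈ H`: the disjoint union of `G` and `H` together with all edges between them. -/
def joinGraph {V W : Type*} (G : SimpleGraph V) (H : SimpleGraph W) : SimpleGraph (V ⊕ W) :=
  (G ⊕g H) ⊔ completeBipartiteGraph V W

/-- `F` contains exactly one cycle, where cycles are counted as subgraphs. -/
def HasExactlyOneCycle {W : Type*} (F : SimpleGraph W) : Prop :=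
  ∃! H : F.Subgraph, ∃ (v : W) (p : F.Walk v v), p.IsCycle ∧ p.toSubgraph = H

end SimpleGraph

/-! Necessity comes from three families of graphs of diameter at most 2 and unbounded treedepth:
balanced complete bipartite graphs, all of whose subgraphs are bipartite; polarity graphs of
projective planes, which have no `C₄`; and the graphs `Pₙ ⋈ K₁` themselves. Treedepth exceeds the
minimum degree, which settles the first two, and it is unbounded on long paths, which settles the
third.

For sufficiency, `F` is first put into a normal form. Deleting the apex from `F ⊆ Pₙ ⋈ K₁` leaves
subpaths, and two apex edges into the same subpath close a cycle. As `F` has one cycle, at most one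
subpath receives two apex edges and none receives more; their distance is `2e + 2` with `e ≥ 1`,
since the cycle is even and not a `C₄`. So `F` lies in `apexPattern e`
(`exists_isContained_apexPattern`).

Large treedepth forces a long path, which is cut into many disjoint paths `q i`. Fix a position `u`.
If no vertex has many neighbors among the `q i u`, diameter 2 supplies fresh two-edge connections
everywhere: they build a cycle of length `2e + 4`, and the rest is added greedily
(`SparseSet.containsOn_apexBox`). Otherwise some hub is adjacent to many of them.

Let `w` be a hub for position 0. Only the cycle is still missing. If `w` is also adjacent to
position `2e + 2` on many paths, one of these gives it. If not, walk through the positions `0, e,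
2e` and then `2, e + 2, 2e + 2`: on many paths the adjacency to `w` first fails at the same position
`u`. A hub `w'` for `u` differs from `w` and links two such paths; two pieces of total length `2e`
and the detour through `w'` close a cycle of length `2e + 4` through `w`
(`DisjointPaths.containsOn_of_two_hubs`). -/

namespace SimpleGraph

open Relation

/-! ### Long paths from large treedepth -/

section DepthForest

variable {V : Type*} {G : SimpleGraph V}

/-- `par` is the parent function and `dep` the depth function of a rooted forest all of whose
edges are edges of `G`. -/
def IsDepthForest (G : SimpleGraph V) (par : V → Option V) (dep : V → ℕ) : Prop :=
  (∀ v u, par v = some u → G.Adj u v ∧ dep v = dep u + 1) ∧ ∀ v, par v = none → dep v = 0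

variable {par : V → Option V} {dep : V → ℕ}

/-- The rooted forest given by a parent function and a depth function. -/
def IsDepthForest.toRootedForest (h : IsDepthForest G par dep) : RootedForest V where
  parent := par
  wf := Subrelation.wf (r := InvImage (· < ·) dep)
    (fun {u v} huv => by
      have := (h.1 v u huv).2
      simp only [InvImage]; omega) (InvImage.wf dep wellFounded_lt)

/-- Climbing to the root follows edges of `G` and lowers the depth by one each time, so no vertex
repeats. Hence a bound on path lengths bounds all depths. -/
theorem IsDepthForest.exists_isPath (h : IsDepthForest G par dep) (n : ℕ) :
    ∀ v, dep v = n → ∃ u, ∃ p : G.Walk v u, p.IsPath ∧ p.length = n ∧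
      ∀ x ∈ p.support, dep x ≤ n := by
  induction n with
  | zero => exact fun v hv => ⟨v, .nil, by simp, rfl, by simp [hv]⟩
  | succ n ih =>
    intro v hv
    cases hp : par v with
    | none => have := h.2 v hp; omega
    | some y =>
      obtain ⟨hadj, hd⟩ := h.1 v y hp
      obtain ⟨u, p, hpath, hlen, hs⟩ := ih y (by omega)
      refine ⟨u, .cons hadj.symm p, ?_, by simp [hlen], ?_⟩
      · rw [Walk.cons_isPath_iff]
        refine ⟨hpath, fun hmem => ?_⟩
        have := hs v hmem
        omega
      · intro x hx
        rw [Walk.support_cons, List.mem_cons] at hx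
        rcases hx with rfl | hx
        · exact hv.le
        · have := hs x hx; omega

theorem IsDepthForest.encard_ancestor_le (h : IsDepthForest G par dep) (n : ℕ) :
    ∀ v, dep v = n → {u | h.toRootedForest.Ancestor u v}.encard ≤ n + 1 := by
  induction n with
  | zero =>
    intro v hv
    have hsub : {u | h.toRootedForest.Ancestor u v} ⊆ {v} := by
      intro u hu
      rcases ReflTransGen.cases_tail hu with h1 | ⟨y, _, hy⟩
      · exact h1.symm
      · have := (h.1 v y hy).2; omega
    exact (Set.encard_le_encard hsub).trans (by simp)
  | succ n ih =>
    intro v hv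
    cases hp : par v with
    | none => have := h.2 v hp; omega
    | some y =>
      have hd := (h.1 v y hp).2
      have hsub : {u | h.toRootedForest.Ancestor u v} ⊆
          insert v {u | h.toRootedForest.Ancestor u y} := by
        intro u hu
        rcases ReflTransGen.cases_tail hu with h1 | ⟨z, hz, hzv⟩
        · exact Or.inl h1.symm
        · have hzv' : par v = some z := hzv
          rw [hp, Option.some.injEq] at hzv'
          subst hzv'
          exact Or.inr hz
      refine (Set.encard_le_encard hsub).trans ((Set.encard_insert_le _ _).trans ?_)
      push_cast
      gcongr
      exact ih y (by omega)

/-- Make `u` the parent of `v`. No cycle arises because `v` is not an ancestor of `u`, and the whole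
subtree of `v` sinks by `dep u + 1 - dep v`, which is positive. -/
theorem IsDepthForest.exists_rehang [Fintype V] (h : IsDepthForest G par dep) {u v : V}
    (huv : G.Adj u v) (hvu : ¬ ReflTransGen (fun a b => par b = some a) v u)
    (hle : dep v ≤ dep u) :
    ∃ par' dep', IsDepthForest G par' dep' ∧ ∑ x, dep x < ∑ x, dep' x := by
  classical
  set R : V → V → Prop := fun a b => par b = some a with hR
  have key : ∀ x y, x ≠ v → par x = some y → (ReflTransGen R v x ↔ ReflTransGen R v y) := by
    intro x y hxv hxy
    refine ⟨fun hx => ?_, fun hy => hy.tail hxy⟩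
    rcases ReflTransGen.cases_tail hx with h1 | ⟨z, hz, hzx⟩
    · exact absurd h1 hxv
    · have hzx' : par x = some z := hzx
      rw [hxy, Option.some.injEq] at hzx'
      exact hzx' ▸ hz
  refine ⟨Function.update par v (some u),
    fun x => if ReflTransGen R v x then dep x + (dep u + 1 - dep v) else dep x, ⟨?_, ?_⟩, ?_⟩
  · intro x y hxy
    by_cases hx : x = v
    · subst hx
      rw [Function.update_self, Option.some.injEq] at hxy
      subst hxy
      refine ⟨huv, ?_⟩
      beta_reduce
      rw [if_pos ReflTransGen.refl, if_neg hvu]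
      omega
    · rw [Function.update_of_ne hx] at hxy
      refine ⟨(h.1 x y hxy).1, ?_⟩
      have h2 := (h.1 x y hxy).2
      simp only [key x y hx hxy]
      split_ifs <;> omega
  · intro x hxn
    have hx : x ≠ v := by rintro rfl; simp at hxn
    rw [Function.update_of_ne hx] at hxn
    beta_reduce
    rw [if_neg]
    · exact h.2 x hxn
    · intro hvx
      rcases ReflTransGen.cases_tail hvx with h1 | ⟨z, _, hzx⟩
      · exact hx h1
      · have hzx' : par x = some z := hzx
        rw [hxn] at hzx'
        cases hzx'
  · refine Finset.sum_lt_sum (fun x _ => ?_) ⟨v, Finset.mem_univ _, ?_⟩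
    · split_ifs <;> omega
    · rw [if_pos ReflTransGen.refl]; omega

/-- A graph with no long path has small treedepth. -/
theorem treedepth_le_of_isPath_length_lt [Finite V] (N : ℕ)
    (hN : ∀ (u v : V) (p : G.Walk u v), p.IsPath → p.length < N) : G.treedepth ≤ N := by
  classical
  have := Fintype.ofFinite V
  have hdep : ∀ {par : V → Option V} {dep : V → ℕ}, IsDepthForest G par dep →
      ∀ v, dep v < N := by
    intro par dep h v
    obtain ⟨u, p, hp, hl, -⟩ := h.exists_isPath (dep v) v rfl
    exact hl ▸ hN _ _ p hp
  by_cases hex : ∃ (par : V → Option V) (dep : V → ℕ) (h : IsDepthForest G par dep),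
      h.toRootedForest.IsEliminationForest G
  · obtain ⟨par, dep, h, hel⟩ := hex
    refine (iInf₂_le h.toRootedForest hel).trans (iSup_le fun v => ?_)
    refine (h.encard_ancestor_le (dep v) v rfl).trans ?_
    exact_mod_cast hdep h v
  · exfalso
    -- If no such forest were an elimination forest, rehanging could be repeated forever and the
    -- depth sum would be unbounded, although every depth is below `N`.
    have hbig : ∀ n : ℕ, ∃ par dep, IsDepthForest G par dep ∧ n ≤ ∑ x, dep x := by
      intro n
      induction n with
      | zero => exact ⟨fun _ => none, fun _ => 0, ⟨by simp, by simp⟩, by simp⟩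
      | succ n ih =>
        obtain ⟨par, dep, h, hn⟩ := ih
        have hne : ¬ h.toRootedForest.IsEliminationForest G := fun hel => hex ⟨_, _, h, hel⟩
        simp only [RootedForest.IsEliminationForest, not_forall, not_or] at hne
        obtain ⟨u, v, huv, h1, h2⟩ := hne
        rcases le_total (dep v) (dep u) with hle | hle
        · obtain ⟨par', dep', h', hlt⟩ := h.exists_rehang huv h2 hle
          exact ⟨par', dep', h', by omega⟩
        · obtain ⟨par', dep', h', hlt⟩ := h.exists_rehang huv.symm h1 hle
          exact ⟨par', dep', h', by omega⟩
    obtain ⟨par, dep, h, hn⟩ := hbig (Fintype.card V * N + 1)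
    have : ∑ x, dep x ≤ ∑ _x : V, N := Finset.sum_le_sum fun x _ => (hdep h x).le
    rw [Finset.sum_const, Finset.card_univ, smul_eq_mul] at this
    omega

end DepthForest

open Relation

/-! ### Lower bounds for treedepth -/

section LowerBound

variable {V : Type*} {G : SimpleGraph V} {T : RootedForest V}

theorem RootedForest.Ancestor.total {a b v : V} (ha : T.Ancestor a v) (hb : T.Ancestor b v) :
    T.Ancestor a b ∨ T.Ancestor b a := by
  induction ha using ReflTransGen.head_induction_on with
  | refl => exact Or.inr hb
  | @head a c hac _ ih =>
    rcases ih with h | h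
    · exact Or.inl (ReflTransGen.head hac h)
    · rcases ReflTransGen.cases_tail h with h1 | ⟨z, hz, hzc⟩
      · subst h1
        exact Or.inl (ReflTransGen.single hac)
      · have h1 : T.parent c = some z := hzc
        have h2 : T.parent c = some a := hac
        rw [h1, Option.some.injEq] at h2
        exact Or.inr (h2 ▸ hz)

theorem RootedForest.Ancestor.antisymm {a b : V} (hab : T.Ancestor a b) (hba : T.Ancestor b a) :
    a = b := by
  by_contra hne
  have h1 : TransGen (fun a b => T.parent b = some a) a b := by
    rcases reflTransGen_iff_eq_or_transGen.1 hab with h | h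
    · exact absurd h.symm hne
    · exact h
  have h2 := h1.trans_left hba
  exact T.wf.transGen.irrefl.irrefl _ h2

theorem RootedForest.ancestor_ncard_lt [Finite V] {a b : V} (hab : T.Ancestor a b) (hne : a ≠ b) :
    {u | T.Ancestor u a}.ncard < {u | T.Ancestor u b}.ncard := by
  refine Set.ncard_lt_ncard ⟨fun u hu => ReflTransGen.trans hu hab, fun hsub => ?_⟩ (Set.toFinite _)
  exact hne (RootedForest.Ancestor.antisymm hab (hsub (ReflTransGen.refl : T.Ancestor b b)))

theorem RootedForest.ancestor_ncard_le [Finite V] {c : ℕ} (hT : T.height ≤ c) (v : V) :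
    {u | T.Ancestor u v}.ncard ≤ c := by
  have h : {u | T.Ancestor u v}.encard ≤ c := (le_iSup (fun v : V => {u | T.Ancestor u v}.encard) v).trans hT
  rw [← (Set.toFinite {u | T.Ancestor u v}).cast_ncard_eq] at h
  exact_mod_cast h

theorem exists_eliminationForest_of_treedepth_le {c : ℕ} (h : G.treedepth ≤ c) :
    ∃ T : RootedForest V, T.IsEliminationForest G ∧ T.height ≤ c := by
  by_contra hcon
  push Not at hcon
  have : ((c + 1 : ℕ) : ℕ∞) ≤ G.treedepth := by
    refine le_iInf₂ fun T hT => ?_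
    have := hcon T hT
    push_cast
    exact Order.add_one_le_of_lt this
  have h2 := this.trans h
  norm_cast at h2
  omega

/-- The treedepth is larger than the minimum degree. -/
theorem lt_of_treedepth_le_of_le_degree [Finite V] [Nonempty V] {c d : ℕ} (h : G.treedepth ≤ c)
    (hd : ∀ v, d ≤ (G.neighborSet v).ncard) : d < c := by
  obtain ⟨T, hT, hc⟩ := exists_eliminationForest_of_treedepth_le h
  obtain ⟨v, hv⟩ := Finite.exists_max (fun v => {u | T.Ancestor u v}.ncard)
  have hsub : insert v (G.neighborSet v) ⊆ {u | T.Ancestor u v} := by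
    rintro u (rfl | hu)
    · exact ReflTransGen.refl
    · rcases hT hu with h1 | h1
      · have := RootedForest.ancestor_ncard_lt h1 hu.ne
        have := hv u
        omega
      · exact h1
  have h1 := Set.ncard_le_ncard hsub (Set.toFinite _)
  rw [Set.ncard_insert_of_notMem (by simp) (Set.toFinite _)] at h1
  have h2 := RootedForest.ancestor_ncard_le hc v
  have h3 := hd v
  omega

/-- Induction on the number `m` of levels available to the path. Its highest vertex in the forest is
an ancestor of all others; removing it leaves two paths with one level less. -/
theorem RootedForest.IsEliminationForest.path_length_le [Finite V] (hT : T.IsEliminationForest G)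
    {c : ℕ} (hc : T.height ≤ c) (f : ℕ → V) (m : ℕ) :
    ∀ a b : ℕ, a ≤ b → Set.InjOn f (Set.Ico a b) →
      (∀ i, a ≤ i → i + 1 < b → G.Adj (f i) (f (i + 1))) →
      (∀ i, a ≤ i → i < b → c < {u | T.Ancestor u (f i)}.ncard + m) → b < a + 2 ^ m := by
  induction m with
  | zero =>
    intro a b hab _ _ hdep
    by_contra hcon
    have := hdep a le_rfl (by omega)
    have := RootedForest.ancestor_ncard_le hc (f a)
    omega
  | succ m ih =>
    intro a b hab hinj hadj hdep
    rcases hab.eq_or_lt with rfl | hlt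
    · have := Nat.two_pow_pos (m + 1); omega
    obtain ⟨s, hs, hmin⟩ := Finset.exists_min_image (Finset.Ico a b)
      (fun i => {u | T.Ancestor u (f i)}.ncard) ⟨a, by simpa using hlt⟩
    rw [Finset.mem_Ico] at hs
    -- Being a descendant of `f s` passes along edges: a neighbor above a descendant is comparable
    -- with `f s` and, by minimality, not strictly above it.
    have step : ∀ i j, a ≤ i → i < b → a ≤ j → j < b → G.Adj (f i) (f j) →
        T.Ancestor (f s) (f i) → T.Ancestor (f s) (f j) := by
      intro i j hi hi' hj hj' hij hsi
      rcases hT hij with h1 | h1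
      · exact ReflTransGen.trans hsi h1
      · rcases RootedForest.Ancestor.total hsi h1 with h2 | h2
        · exact h2
        · by_cases hne : f j = f s
          · rw [hne]; exact ReflTransGen.refl
          · have := RootedForest.ancestor_ncard_lt h2 hne
            have := hmin j (Finset.mem_Ico.2 ⟨hj, hj'⟩)
            omega
    have hup : ∀ t, s + t < b → T.Ancestor (f s) (f (s + t)) := by
      intro t
      induction t with
      | zero => exact fun _ => ReflTransGen.refl
      | succ t iht =>
        intro ht
        exact step (s + t) (s + (t + 1)) (by omega) (by omega) (by omega) ht
          (hadj (s + t) (by omega) (by omega)) (iht (by omega))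
    have hdown : ∀ t, a + t ≤ s → T.Ancestor (f s) (f (s - t)) := by
      intro t
      induction t with
      | zero => exact fun _ => ReflTransGen.refl
      | succ t iht =>
        intro ht
        have h1 := hadj (s - (t + 1)) (by omega) (by omega)
        rw [show s - (t + 1) + 1 = s - t by omega] at h1
        exact step (s - t) (s - (t + 1)) (by omega) (by omega) (by omega) (by omega)
          h1.symm (iht (by omega))
    have hall : ∀ i, a ≤ i → i < b → T.Ancestor (f s) (f i) := by
      intro i hi hi'
      rcases le_total s i with h | h
      · have := hup (i - s) (by omega)
        rwa [Nat.add_sub_cancel' h] at this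
      · have := hdown (s - i) (by omega)
        rwa [Nat.sub_sub_self h] at this
    have hgt : ∀ i, a ≤ i → i < b → i ≠ s → c < {u | T.Ancestor u (f i)}.ncard + m := by
      intro i hi hi' hne
      have h1 := RootedForest.ancestor_ncard_lt (hall i hi hi')
        (fun h => hne (hinj ⟨hi, hi'⟩ ⟨hs.1, hs.2⟩ h.symm))
      have h2 := hdep s hs.1 hs.2
      omega
    have hl := ih a s hs.1 (hinj.mono (Set.Ico_subset_Ico le_rfl hs.2.le))
      (fun i hi hi' => hadj i hi (by omega)) (fun i hi hi' => hgt i hi (by omega) (by omega))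
    have hr := ih (s + 1) b hs.2 (hinj.mono (Set.Ico_subset_Ico (by omega) le_rfl))
      (fun i hi hi' => hadj i (by omega) (by omega))
      (fun i hi hi' => hgt i (by omega) (by omega) (by omega))
    rw [pow_succ]
    omega

/-- A graph of treedepth at most `c` has no path on `2 ^ c` vertices. -/
theorem lt_two_pow_of_treedepth_le [Finite V] {c n : ℕ} (h : G.treedepth ≤ c) (f : ℕ → V)
    (hinj : Set.InjOn f (Set.Ico 0 n)) (hadj : ∀ i, i + 1 < n → G.Adj (f i) (f (i + 1))) :
    n < 2 ^ c := by
  obtain ⟨T, hT, hc⟩ := exists_eliminationForest_of_treedepth_le h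
  have := hT.path_length_le hc f c 0 n (Nat.zero_le _) hinj (fun i _ hi => hadj i hi)
    (fun i _ _ => ?_)
  · simpa using this
  · have : 0 < {u | T.Ancestor u (f i)}.ncard :=
      (Set.ncard_pos (Set.toFinite _)).2 ⟨f i, ReflTransGen.refl⟩
    omega

end LowerBound

/-! ### Diameter at most two as existence of common neighbors -/

section Diameter

variable {V : Type*} {G : SimpleGraph V}

theorem ediam_le_two (h : ∀ u v, u ≠ v → ¬ G.Adj u v → ∃ c, G.Adj u c ∧ G.Adj c v) :
    G.ediam ≤ 2 := by
  refine ediam_le_of_edist_le fun u v => ?_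
  by_cases huv : u = v
  · subst huv; simp
  by_cases hadj : G.Adj u v
  · refine (edist_le (Walk.cons hadj .nil)).trans ?_
    simp
  · obtain ⟨c, h1, h2⟩ := h u v huv hadj
    refine (edist_le (Walk.cons h1 (.cons h2 .nil))).trans ?_
    simp

theorem exists_common_adj_of_ediam_le_two (h : G.ediam ≤ 2) {u v : V} (huv : u ≠ v)
    (hadj : ¬ G.Adj u v) : ∃ c, G.Adj u c ∧ G.Adj c v := by
  have h1 : G.edist u v ≤ 2 := edist_le_ediam.trans h
  obtain ⟨p, hp⟩ := exists_walk_of_edist_ne_top (G := G) (u := u) (v := v) (by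
    intro htop; rw [htop] at h1; simp at h1)
  rw [← hp] at h1
  have h2 : p.length ≤ 2 := by exact_mod_cast h1
  match p, h2 with
  | .nil, _ => exact absurd rfl huv
  | .cons a .nil, _ => exact absurd a hadj
  | .cons a (.cons b .nil), _ => exact ⟨_, a, b⟩
  | .cons a (.cons b (.cons c q)), h2 => simp at h2

end Diameter

/-! ### Necessity: three families of unbounded treedepth -/

section Hosts

variable {W : Type*} {F : SimpleGraph W}

theorem isBipartite_of_hasBoundedTreedepth
    (h : HasBoundedTreedepth (fun _ G => F.Free G ∧ G.ediam ≤ 2)) : F.IsBipartite := by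
  obtain ⟨c, hc⟩ := h
  by_contra hF
  set K := completeBipartiteGraph (Fin (c + 1)) (Fin (c + 1)) with hK
  have hfree : F.Free K := by
    rintro ⟨f⟩
    refine hF ⟨Coloring.mk (fun w => if (f w).isLeft then 0 else 1) ?_⟩
    intro v w hvw
    have := f.toHom.map_adj hvw
    simp only [hK, completeBipartiteGraph_adj, Copy.toHom_apply] at this
    rcases this with ⟨h1, h2⟩ | ⟨h1, h2⟩
    · simp [h1, Sum.not_isLeft.mpr h2]
    · simp [h2, Sum.not_isLeft.mpr h1]
  have hdiam : K.ediam ≤ 2 := by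
    refine ediam_le_two fun u v _ hadj => ?_
    rcases u with u | u <;> rcases v with v | v
    · exact ⟨.inr 0, by simp [hK], by simp [hK]⟩
    · simp [hK] at hadj
    · simp [hK] at hadj
    · exact ⟨.inl 0, by simp [hK], by simp [hK]⟩
  have := lt_of_treedepth_le_of_le_degree (d := c + 1) (hc _ K ⟨hfree, hdiam⟩) (by
    rintro (u | u)
    · have : K.neighborSet (.inl u) = Set.range Sum.inr := by
        ext (x | x) <;> simp [hK]
      rw [this, ← Set.image_univ, Set.ncard_image_of_injective _ Sum.inr_injective]
      simp
    · have : K.neighborSet (.inr u) = Set.range Sum.inl := by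
        ext (x | x) <;> simp [hK]
      rw [this, ← Set.image_univ, Set.ncard_image_of_injective _ Sum.inl_injective]
      simp)
  omega

open Configuration Configuration.ofField Projectivization
open scoped LinearAlgebra.Projectivization

/-- The graph on the points of the projective plane over `K` in which distinct points are adjacent
when they are orthogonal. -/
def polarityGraph (K : Type*) [Field K] : SimpleGraph (ℙ K (Fin 3 → K)) where
  Adj u v := u ≠ v ∧ orthogonal u v
  symm := ⟨fun _ _ h => ⟨h.1.symm, orthogonal_comm.1 h.2⟩⟩
  loopless := ⟨fun _ h => h.1 rfl⟩

/-- The cross product of two points is orthogonal to both; it equals neither of them unless they are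
orthogonal to each other. -/
theorem ediam_polarityGraph_le (K : Type*) [Field K] : (polarityGraph K).ediam ≤ 2 := by
  classical
  refine ediam_le_two fun u v huv hadj => ?_
  have h1 := orthogonal_cross_left huv
  have h2 := orthogonal_cross_right huv
  have hort : ¬ orthogonal u v := fun h => hadj ⟨huv, h⟩
  exact ⟨cross u v, ⟨fun h => hort (by rw [← h] at h2; exact orthogonal_comm.1 h2), h1⟩,
    ⟨fun h => hort (by rw [h] at h1; exact h1), orthogonal_comm.1 h2⟩⟩

/-- Two distinct points lie on only one common line, so opposite vertices of a four-cycle would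
coincide. -/
theorem cycleGraph_four_free_polarityGraph (K : Type*) [Field K] :
    (cycleGraph 4).Free (polarityGraph K) := by
  rintro ⟨f⟩
  have adj : ∀ i j, (cycleGraph 4).Adj i j → orthogonal (f i) (f j) :=
    fun i j h => (f.toHom.map_adj h).2
  rcases eq_or_eq_of_orthogonal (adj 0 1 (by decide)) (adj 2 1 (by decide)) (adj 0 3 (by decide))
    (adj 2 3 (by decide)) with h | h
  · exact absurd (f.injective h) (by decide)
  · exact absurd (f.injective h) (by decide)

theorem le_degree_polarityGraph (p : ℕ) [Fact p.Prime] (v : ℙ (ZMod p) (Fin 3 → ZMod p)) :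
    p ≤ ((polarityGraph (ZMod p)).neighborSet v).ncard := by
  classical
  have : Fintype (ℙ (ZMod p) (Fin 3 → ZMod p)) := Fintype.ofFinite (ℙ (ZMod p) (Fin 3 → ZMod p))
  have hcard := ProjectivePlane.card_points (ℙ (ZMod p) (Fin 3 → ZMod p)) (ℙ (ZMod p) (Fin 3 → ZMod p))
  have hcard2 : Nat.card (ℙ (ZMod p) (Fin 3 → ZMod p)) = ∑ i ∈ Finset.range 3, p ^ i := by
    have := Projectivization.card_of_finrank (ZMod p) (Fin 3 → ZMod p) (n := 3) (by simp)
    rw [Nat.card_zmod] at this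
    exact this
  rw [← Nat.card_eq_fintype_card, hcard2] at hcard
  simp only [Finset.sum_range_succ, Finset.sum_range_zero] at hcard
  -- The order `n` of the plane satisfies `n² + n + 1 = p² + p + 1`.
  have hord : p ≤ ProjectivePlane.order (ℙ (ZMod p) (Fin 3 → ZMod p)) (ℙ (ZMod p) (Fin 3 → ZMod p)) := by
    by_contra hlt
    nlinarith
  have hline := ProjectivePlane.pointCount_eq (ℙ (ZMod p) (Fin 3 → ZMod p)) v
  rw [pointCount, ← Set.coe_ofPred, Nat.card_coe_set_eq] at hline
  -- The polar line of `v` has `n + 1` points; at most one is lost, namely `v` itself when it is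
  -- self-orthogonal.
  have hsub : {x : ℙ (ZMod p) (Fin 3 → ZMod p) | x ∈ v} ⊆ insert v ((polarityGraph (ZMod p)).neighborSet v) := by
    intro x hx
    by_cases hxv : x = v
    · exact Or.inl hxv
    · exact Or.inr ⟨fun h => hxv h.symm, orthogonal_comm.1 hx⟩
  have h1 := Set.ncard_le_ncard hsub (Set.toFinite _)
  have h2 := Set.ncard_insert_le v ((polarityGraph (ZMod p)).neighborSet v)
  omega

theorem cycleGraph_four_free_of_hasBoundedTreedepth
    (h : HasBoundedTreedepth (fun _ G => F.Free G ∧ G.ediam ≤ 2)) : (cycleGraph 4).Free F := by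
  obtain ⟨c, hc⟩ := h
  intro hF
  obtain ⟨p, hp, hprime⟩ := Nat.exists_infinite_primes c
  have : Fact p.Prime := ⟨hprime⟩
  have hne : Nonempty (ℙ (ZMod p) (Fin 3 → ZMod p)) :=
    ⟨.mk _ ![1, 0, 0] (by simp)⟩
  have := lt_of_treedepth_le_of_le_degree (d := p)
    (hc _ (polarityGraph (ZMod p))
      ⟨fun h => cycleGraph_four_free_polarityGraph _ (hF.trans h), ediam_polarityGraph_le _⟩)
    (le_degree_polarityGraph p)
  omega

theorem isContained_joinGraph_of_hasBoundedTreedepth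
    (h : HasBoundedTreedepth (fun _ G => F.Free G ∧ G.ediam ≤ 2)) :
    ∃ n : ℕ, F.IsContained (joinGraph (pathGraph n) (⊤ : SimpleGraph (Fin 1))) := by
  obtain ⟨c, hc⟩ := h
  by_contra hF
  push Not at hF
  set n := 2 ^ c with hn
  have hpos : 0 < n := Nat.two_pow_pos c
  set J := joinGraph (pathGraph n) (⊤ : SimpleGraph (Fin 1)) with hJ
  have hdiam : J.ediam ≤ 2 := by
    refine ediam_le_two fun u v huv hadj => ?_
    rcases u with u | u <;> rcases v with v | v
    · exact ⟨.inr 0, by simp [hJ, joinGraph], by simp [hJ, joinGraph]⟩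
    · simp [hJ, joinGraph] at hadj
    · simp [hJ, joinGraph] at hadj
    · exact absurd (by rw [Subsingleton.elim u v]) huv
  have := lt_two_pow_of_treedepth_le (n := n) (hc _ J ⟨not_nonempty_iff.2 (hF n), hdiam⟩)
    -- The reduction modulo `n` only extends the path to a function on `ℕ`; it is trivial on the
    -- indices used.
    (fun i => .inl ⟨i % n, Nat.mod_lt _ hpos⟩) (by
      intro i hi j hj hij
      simp only [Sum.inl.injEq, Fin.mk.injEq] at hij
      rwa [Nat.mod_eq_of_lt hi.2, Nat.mod_eq_of_lt hj.2] at hij) (by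
      intro i hi
      simp [hJ, joinGraph, pathGraph_adj, Nat.mod_eq_of_lt hi, Nat.mod_eq_of_lt (Nat.lt_of_succ_lt hi)])
  omega

end Hosts

/-- An apex vertex `none` and infinitely many two-way infinite paths. The apex is adjacent to the
origin of every path, and to the vertex `2 * e + 2` of the path `0`. -/
def apexPattern (e : ℕ) : SimpleGraph (Option (ℕ × ℤ)) :=
  fromRel fun a b => match a, b with
    | none, some (j, x) => x = 0 ∨ (j = 0 ∧ x = 2 * e + 2)
    | some (i, x), some (j, y) => i = j ∧ y = x + 1
    | _, _ => False

theorem apexPattern_adj_none_some {e j : ℕ} {x : ℤ} :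
    (apexPattern e).Adj none (some (j, x)) ↔ x = 0 ∨ (j = 0 ∧ x = 2 * e + 2) := by
  simp [apexPattern, fromRel_adj]

theorem apexPattern_adj_some_some {e i j : ℕ} {x y : ℤ} :
    (apexPattern e).Adj (some (i, x)) (some (j, y)) ↔ i = j ∧ (y = x + 1 ∨ x = y + 1) := by
  simp only [apexPattern, fromRel_adj, ne_eq, Option.some.injEq, Prod.mk.injEq, not_and]
  constructor
  · rintro ⟨-, ⟨h1, h2⟩ | ⟨h1, h2⟩⟩
    · exact ⟨h1, Or.inl h2⟩
    · exact ⟨h1.symm, Or.inr h2⟩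
  · rintro ⟨rfl, h | h⟩
    · exact ⟨fun _ => by omega, Or.inl ⟨rfl, h⟩⟩
    · exact ⟨fun _ => by omega, Or.inr ⟨rfl, h⟩⟩

/-! ### Normal form of `F`: embedding into the apex pattern -/

section ApexPosition

variable {W : Type*} {F : SimpleGraph W} {pos : W → Option ℕ}

/-- The copy of the path edge from position `i` to position `i + 1` belongs to `F`. -/
def PathEdge (F : SimpleGraph W) (pos : W → Option ℕ) (i : ℕ) : Prop :=
  ∃ v w, F.Adj v w ∧ pos v = some i ∧ pos w = some (i + 1)

/-- The copy of the edge from the apex to position `i` belongs to `F`. -/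
def ApexEdge (F : SimpleGraph W) (pos : W → Option ℕ) (i : ℕ) : Prop :=
  ∃ a v, F.Adj a v ∧ pos a = none ∧ pos v = some i

open Classical in
/-- The component of position `i` after the removal of the apex, numbered from the left. -/
noncomputable def segment (F : SimpleGraph W) (pos : W → Option ℕ) (i : ℕ) : ℕ :=
  Nat.count (fun q => ¬ PathEdge F pos q) i

theorem segment_succ_of_pathEdge {i : ℕ} (h : PathEdge F pos i) :
    segment F pos (i + 1) = segment F pos i := by
  classical
  simp [segment, Nat.count_succ, h]

theorem pathEdge_of_segment_eq {x y q : ℕ} (hxy : segment F pos x = segment F pos y)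
    (hx : x ≤ q) (hy : q < y) : PathEdge F pos q := by
  classical
  by_contra h
  have h1 : segment F pos x ≤ segment F pos q := Nat.count_monotone _ hx
  have h2 : segment F pos (q + 1) ≤ segment F pos y := Nat.count_monotone _ hy
  have h3 : segment F pos (q + 1) = segment F pos q + 1 := by
    simp [segment, Nat.count_succ, h]
  omega

theorem exists_isPath_of_pathEdge (hinj : Function.Injective pos) (t : ℕ) :
    ∀ x u v, pos u = some x → pos v = some (x + t) →
      (∀ q, x ≤ q → q < x + t → PathEdge F pos q) →
      ∃ p : F.Walk u v, p.IsPath ∧ p.length = t ∧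
        ∀ w, w ∈ p.support ↔ ∃ q, x ≤ q ∧ q ≤ x + t ∧ pos w = some q := by
  induction t with
  | zero =>
    intro x u v hu hv _
    have : u = v := hinj (hu.trans hv.symm)
    subst this
    refine ⟨.nil, by simp, rfl, fun w => ?_⟩
    rw [Walk.support_nil, List.mem_singleton]
    constructor
    · rintro rfl
      exact ⟨x, le_rfl, le_rfl, hu⟩
    · rintro ⟨q, h1, h2, h3⟩
      exact hinj (h3.trans (by rw [hu]; congr 1; omega))
  | succ t ih =>
    intro x u v hu hv hE
    obtain ⟨u', y, hadj, hu', hy⟩ := hE x le_rfl (by omega)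
    have : u' = u := hinj (hu'.trans hu.symm)
    subst this
    obtain ⟨p, hp, hl, hs⟩ := ih (x + 1) y v hy (by rw [hv]; congr 1; omega)
      (fun q h1 h2 => hE q (by omega) (by omega))
    refine ⟨.cons hadj p, ?_, by simp [hl], fun w => ?_⟩
    · rw [Walk.cons_isPath_iff]
      refine ⟨hp, fun hmem => ?_⟩
      obtain ⟨q, h1, h2, h3⟩ := (hs _).1 hmem
      rw [hu, Option.some.injEq] at h3
      omega
    · rw [Walk.support_cons, List.mem_cons, hs]
      constructor
      · rintro (rfl | ⟨q, h1, h2, h3⟩)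
        · exact ⟨x, le_rfl, by omega, hu⟩
        · exact ⟨q, by omega, by omega, h3⟩
      · rintro ⟨q, h1, h2, h3⟩
        by_cases hq : q = x
        · subst hq; exact Or.inl (hinj (h3.trans hu.symm))
        · exact Or.inr ⟨q, by omega, by omega, h3⟩

theorem exists_isCycle_of_apexEdge (hinj : Function.Injective pos) {x y : ℕ} (hxy : x < y)
    (hx : ApexEdge F pos x) (hy : ApexEdge F pos y) (hseg : segment F pos x = segment F pos y) :
    ∃ a, ∃ p : F.Walk a a, p.IsCycle ∧ p.length = y - x + 2 ∧
      ∀ w, w ∈ p.support ↔ pos w = none ∨ ∃ q, x ≤ q ∧ q ≤ y ∧ pos w = some q := by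
  obtain ⟨a, u, hau, ha, hu⟩ := hx
  obtain ⟨a', v, hav, ha', hv⟩ := hy
  have : a' = a := hinj (ha'.trans ha.symm)
  subst this
  obtain ⟨p, hp, hl, hs⟩ := exists_isPath_of_pathEdge (F := F) hinj (y - x) x u v hu
    (by rw [hv]; congr 1; omega)
    (fun q h1 h2 => pathEdge_of_segment_eq hseg h1 (by omega))
  have hsa : a' ∉ p.support := by
    intro h
    obtain ⟨q, -, -, h3⟩ := (hs _).1 h
    rw [ha] at h3
    cases h3
  refine ⟨a', .cons hau (p.concat hav.symm), ?_, by simp [hl], fun w => ?_⟩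
  · rw [Walk.cons_isCycle_iff]
    refine ⟨hp.concat hsa _, fun hmem => ?_⟩
    rw [Walk.edges_concat, List.concat_eq_append, List.mem_append, List.mem_singleton] at hmem
    rcases hmem with hmem | hmem
    · exact hsa (Walk.fst_mem_support_of_mem_edges _ hmem)
    · rw [Sym2.eq_swap, Sym2.congr_left] at hmem
      rw [hmem, hv, Option.some.injEq] at hu
      omega
  · rw [Walk.support_cons, List.mem_cons, Walk.support_concat,
      List.mem_append, List.mem_singleton, hs, Nat.add_sub_cancel' hxy.le]
    constructor
    · rintro (rfl | h | rfl)
      · exact Or.inl ha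
      · exact Or.inr h
      · exact Or.inl ha
    · rintro (h | h)
      · exact Or.inl (hinj (h.trans ha.symm))
      · exact Or.inr (Or.inl h)

theorem exists_pos_eq_of_segment_eq {x y q : ℕ} (hx : ApexEdge F pos x)
    (hseg : segment F pos x = segment F pos y) (h1 : x ≤ q) (h2 : q ≤ y) :
    ∃ w, pos w = some q := by
  rcases h1.eq_or_lt with rfl | h1
  · obtain ⟨_, v, _, _, hv⟩ := hx
    exact ⟨v, hv⟩
  · obtain ⟨_, w, -, -, hw⟩ := pathEdge_of_segment_eq (q := q - 1) hseg (by omega) (by omega)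
    exact ⟨w, by rw [hw]; congr 1; omega⟩

/-- Each pair closes a cycle whose vertices are the apex and an interval of positions. Both cycles
are the same subgraph, so the intervals agree. -/
theorem apexEdge_pair_unique (hF : F.HasExactlyOneCycle) (hinj : Function.Injective pos)
    {x y x' y' : ℕ} (hxy : x < y) (hx : ApexEdge F pos x) (hy : ApexEdge F pos y)
    (hseg : segment F pos x = segment F pos y) (hxy' : x' < y') (hx' : ApexEdge F pos x')
    (hy' : ApexEdge F pos y') (hseg' : segment F pos x' = segment F pos y') :
    x = x' ∧ y = y' := by
  obtain ⟨a, p, hp, -, hs⟩ := exists_isCycle_of_apexEdge hinj hxy hx hy hseg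
  obtain ⟨a', p', hp', -, hs'⟩ := exists_isCycle_of_apexEdge hinj hxy' hx' hy' hseg'
  have heq : p.toSubgraph = p'.toSubgraph :=
    hF.unique ⟨a, p, hp, rfl⟩ ⟨a', p', hp', rfl⟩
  have hmem : ∀ w, w ∈ p.support ↔ w ∈ p'.support := by
    intro w
    rw [← Walk.mem_verts_toSubgraph, heq, Walk.mem_verts_toSubgraph]
  have hiff : ∀ q, (x ≤ q ∧ q ≤ y) → (x' ≤ q ∧ q ≤ y') := by
    rintro q ⟨h1, h2⟩
    obtain ⟨w, hw⟩ := exists_pos_eq_of_segment_eq hx hseg h1 h2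
    have := (hs' w).1 ((hmem w).1 ((hs w).2 (Or.inr ⟨q, h1, h2, hw⟩)))
    rw [hw] at this
    simpa using this
  have hiff' : ∀ q, (x' ≤ q ∧ q ≤ y') → (x ≤ q ∧ q ≤ y) := by
    rintro q ⟨h1, h2⟩
    obtain ⟨w, hw⟩ := exists_pos_eq_of_segment_eq hx' hseg' h1 h2
    have := (hs w).1 ((hmem w).2 ((hs' w).2 (Or.inr ⟨q, h1, h2, hw⟩)))
    rw [hw] at this
    simpa using this
  have := hiff x ⟨le_rfl, hxy.le⟩
  have := hiff y ⟨hxy.le, le_rfl⟩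
  have := hiff' x' ⟨le_rfl, hxy'.le⟩
  have := hiff' y' ⟨hxy'.le, le_rfl⟩
  omega

/-- The closed cycle has length `y - x + 2`. It is even as `F` is bipartite, and it is not 4. -/
theorem apexEdge_pair_gap (hbip : F.IsBipartite) (hC4 : (cycleGraph 4).Free F)
    (hinj : Function.Injective pos) {x y : ℕ} (hxy : x < y) (hx : ApexEdge F pos x)
    (hy : ApexEdge F pos y) (hseg : segment F pos x = segment F pos y) :
    ∃ e : ℕ, 1 ≤ e ∧ y = x + (2 * e + 2) := by
  obtain ⟨a, p, hp, hl, -⟩ := exists_isCycle_of_apexEdge hinj hxy hx hy hseg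
  have heven : Even p.length := two_colorable_iff_forall_loop_even.1 hbip a p
  have hne : y ≠ x + 2 := by
    rintro rfl
    obtain ⟨a, u, hau, ha, hu⟩ := hx
    obtain ⟨a', v, hav, ha', hv⟩ := hy
    obtain ⟨u', m, hum, hu', hm⟩ := pathEdge_of_segment_eq (q := x) hseg le_rfl (by omega)
    obtain ⟨m', v', hmv, hm', hv'⟩ := pathEdge_of_segment_eq (q := x + 1) hseg (by omega) (by omega)
    obtain rfl : a' = a := hinj (ha'.trans ha.symm)
    obtain rfl : u' = u := hinj (hu'.trans hu.symm)
    obtain rfl : m' = m := hinj (hm'.trans hm.symm)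
    obtain rfl : v' = v := hinj (hv'.trans hv.symm)
    have huv : u' ≠ v' := by rintro rfl; rw [hu, Option.some.injEq] at hv; omega
    have ham : a' ≠ m' := by rintro rfl; rw [ha] at hm; cases hm
    refine hC4 ⟨⟨⟨![a', u', m', v'], ?_⟩, ?_⟩⟩
    · intro i j hij
      have : (i = 0 ∧ j = 1) ∨ (i = 1 ∧ j = 2) ∨ (i = 2 ∧ j = 3) ∨ (i = 3 ∧ j = 0) ∨
        (i = 1 ∧ j = 0) ∨ (i = 2 ∧ j = 1) ∨ (i = 3 ∧ j = 2) ∨ (i = 0 ∧ j = 3) := by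
        revert i j; decide
      rcases this with ⟨rfl, rfl⟩ | ⟨rfl, rfl⟩ | ⟨rfl, rfl⟩ | ⟨rfl, rfl⟩ | ⟨rfl, rfl⟩ |
        ⟨rfl, rfl⟩ | ⟨rfl, rfl⟩ | ⟨rfl, rfl⟩
      exacts [hau, hum, hmv, hav.symm, hau.symm, hum.symm, hmv.symm, hav]
    · intro i j hij
      have h1 := hau.ne
      have h2 := hum.ne
      have h3 := hmv.ne
      have h4 := hav.ne
      fin_cases i <;> fin_cases j <;> simp_all
  rw [hl] at heven
  obtain ⟨s, hs⟩ := heven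
  exact ⟨s - 2, by omega, by omega⟩

theorem isContained_apexPattern (hF : F.HasExactlyOneCycle) (hbip : F.IsBipartite)
    (hC4 : (cycleGraph 4).Free F) (hinj : Function.Injective pos)
    (hadj : ∀ v w i j, F.Adj v w → pos v = some i → pos w = some j → i + 1 = j ∨ j + 1 = i) :
    ∃ e : ℕ, 1 ≤ e ∧ F.IsContained (apexPattern e) := by
  classical
  obtain ⟨e, j₀, he, hpair⟩ : ∃ e j₀ : ℕ, 1 ≤ e ∧ ∀ x y, x < y → ApexEdge F pos x →
      ApexEdge F pos y → segment F pos x = segment F pos y →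
      y = x + (2 * e + 2) ∧ segment F pos x = j₀ := by
    by_cases hex : ∃ x y, x < y ∧ ApexEdge F pos x ∧ ApexEdge F pos y ∧
        segment F pos x = segment F pos y
    · obtain ⟨x, y, hxy, hx, hy, hseg⟩ := hex
      obtain ⟨e, he, hgap⟩ := apexEdge_pair_gap hbip hC4 hinj hxy hx hy hseg
      refine ⟨e, segment F pos x, he, fun x' y' hxy' hx' hy' hseg' => ?_⟩
      obtain ⟨rfl, rfl⟩ := apexEdge_pair_unique hF hinj hxy hx hy hseg hxy' hx' hy' hseg'
      exact ⟨hgap, rfl⟩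
    · exact ⟨1, 0, le_rfl, fun x y h1 h2 h3 h4 => absurd ⟨x, y, h1, h2, h3, h4⟩ hex⟩
  -- The leftmost apex edge of a component becomes the origin of its path. A component without apex
  -- edges gets the default `sInf ∅ = 0`, which is harmless.
  set c : ℕ → ℕ := fun j => sInf {x | ApexEdge F pos x ∧ segment F pos x = j} with hc
  -- The component with two apex edges must land on path 0, the only one with a second apex edge.
  set σ := Equiv.swap j₀ 0 with hσ
  set φ : W → Option (ℕ × ℤ) := fun w => (pos w).map
    fun i => (σ (segment F pos i), (i : ℤ) - c (segment F pos i)) with hφ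
  have hnone : ∀ w, pos w = none → φ w = none := fun w h => by simp [hφ, h]
  have hsome : ∀ w i, pos w = some i →
      φ w = some (σ (segment F pos i), (i : ℤ) - c (segment F pos i)) :=
    fun w i h => by simp [hφ, h]
  have happ : ∀ v w i, F.Adj v w → pos v = none → pos w = some i →
      (apexPattern e).Adj (φ v) (φ w) := by
    intro v w i hvw hv hw
    rw [hnone v hv, hsome w i hw, apexPattern_adj_none_some]
    have hX : ApexEdge F pos i := ⟨v, w, hvw, hv, hw⟩
    have hmem : i ∈ {x | ApexEdge F pos x ∧ segment F pos x = segment F pos i} := ⟨hX, rfl⟩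
    have hle : c (segment F pos i) ≤ i := Nat.sInf_le hmem
    obtain ⟨hcX, hcs⟩ : c (segment F pos i) ∈
      {x | ApexEdge F pos x ∧ segment F pos x = segment F pos i} := Nat.sInf_mem ⟨i, hmem⟩
    rcases hle.eq_or_lt with heq | hlt
    · left; omega
    · right
      obtain ⟨h1, h2⟩ := hpair _ _ hlt hcX hX hcs
      rw [hcs] at h2
      refine ⟨by rw [h2, hσ, Equiv.swap_apply_left], by omega⟩
  have hpath : ∀ v w i, F.Adj v w → pos v = some i → pos w = some (i + 1) →
      (apexPattern e).Adj (φ v) (φ w) := by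
    intro v w i hvw hv hw
    have hs := segment_succ_of_pathEdge (F := F) (pos := pos) ⟨v, w, hvw, hv, hw⟩
    rw [hsome v i hv, hsome w _ hw, apexPattern_adj_some_some, hs]
    exact ⟨rfl, Or.inl (by push_cast; ring)⟩
  refine ⟨e, he, ⟨⟨⟨φ, fun {v w} hvw => ?_⟩, fun v w hvw => ?_⟩⟩⟩
  · cases hv : pos v with
    | none =>
      cases hw : pos w with
      | none => exact absurd (hinj (hv.trans hw.symm)) hvw.ne
      | some j => exact happ v w j hvw hv hw
    | some i =>
      cases hw : pos w with
      | none => exact (happ w v i hvw.symm hw hv).symm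
      | some j =>
        rcases hadj v w i j hvw hv hw with rfl | rfl
        · exact hpath v w i hvw hv hw
        · exact (hpath w v j hvw.symm hw hv).symm
  · replace hvw : φ v = φ w := hvw
    apply hinj
    cases hv : pos v with
    | none =>
      cases hw : pos w with
      | none => rfl
      | some j => rw [hnone v hv, hsome w j hw] at hvw; cases hvw
    | some i =>
      cases hw : pos w with
      | none => rw [hnone w hw, hsome v i hv] at hvw; cases hvw
      | some j =>
        rw [hsome v i hv, hsome w j hw, Option.some.injEq, Prod.mk.injEq] at hvw
        obtain ⟨h1, h2⟩ := hvw
        rw [σ.injective h1] at h2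
        congr 1
        omega

/-- A bipartite `C₄`-free graph with exactly one cycle that is a subgraph of some `Pₙ ⋈ K₁` is a
subgraph of some `apexPattern`. -/
theorem exists_isContained_apexPattern (hF : F.HasExactlyOneCycle) (hbip : F.IsBipartite)
    (hC4 : (cycleGraph 4).Free F) {n : ℕ}
    (hn : F.IsContained (joinGraph (pathGraph n) (⊤ : SimpleGraph (Fin 1)))) :
    ∃ e : ℕ, 1 ≤ e ∧ F.IsContained (apexPattern e) := by
  obtain ⟨f⟩ := hn
  refine isContained_apexPattern
    (pos := fun w => Sum.elim (fun i : Fin n => some (i : ℕ)) (fun _ => none) (f w))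
    hF hbip hC4 ?_ ?_
  · intro v w hvw
    apply f.injective
    simp only [Copy.coe_toHom]
    rcases hv : f v with i | i <;> rcases hw : f w with j | j <;>
      simp only [hv, hw, Sum.elim_inl, Sum.elim_inr, Option.some.injEq, reduceCtorEq] at hvw
    · rw [Fin.ext hvw]
    · rw [Subsingleton.elim i j]
  · intro v w i j hvw hv hw
    have h := f.toHom.map_adj hvw
    simp only [Copy.toHom_apply] at h
    rcases hv' : f v with a | a <;> rcases hw' : f w with b | b <;>
      simp only [hv', hw', Sum.elim_inl, Sum.elim_inr, Option.some.injEq, reduceCtorEq] at hv hw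
    rw [hv', hw'] at h
    simp [joinGraph, pathGraph_adj] at h
    omega

end ApexPosition

/-! ### Greedy extension of an embedding -/

section ContainsOn

variable {V X : Type*} {G : SimpleGraph V} {H : SimpleGraph X}

/-- The subgraph of `H` induced by the finite set `A` is contained in `G`. -/
def ContainsOn (H : SimpleGraph X) (A : Finset X) (G : SimpleGraph V) : Prop :=
  ∃ φ : X → V, Set.InjOn φ A ∧ ∀ a ∈ A, ∀ b ∈ A, H.Adj a b → G.Adj (φ a) (φ b)

theorem ContainsOn.isContained {W : Type*} {F : SimpleGraph W} {A : Finset X}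
    (h : ContainsOn H A G) (f : Copy F H) (hf : ∀ w, f w ∈ A) : F.IsContained G := by
  obtain ⟨φ, hinj, hadj⟩ := h
  exact ⟨⟨⟨fun w => φ (f w), fun {v w} hvw => hadj _ (hf v) _ (hf w) (f.toHom.map_adj hvw)⟩,
    fun v w hvw => f.injective (hinj (hf v) (hf w) hvw)⟩⟩

/-- Greedy embedding: in a graph in which the degrees are large, an embedding of a core extends to
all vertices if every vertex outside the core has at most one neighbor that is in the core or
precedes it. -/
theorem ContainsOn.extend [Nonempty V] {A₀ A : Finset X} (ρ : X → ℕ)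
    (hdeg : ∀ v, ∀ S : Finset V, S.card ≤ A.card → ∃ d ∉ S, G.Adj v d)
    (h₀ : ContainsOn H A₀ G)
    (huniq : ∀ v ∉ A₀, ∀ u u', H.Adj v u → H.Adj v u' → (u ∈ A₀ ∨ ρ u ≤ ρ v) →
      (u' ∈ A₀ ∨ ρ u' ≤ ρ v) → u = u') (n : ℕ) :
    ∀ B : Finset X, A₀ ⊆ B → B ⊆ A → B.card = A₀.card + n → ContainsOn H B G := by
  classical
  induction n with
  | zero =>
    intro B hAB _ hcard
    rwa [← Finset.eq_of_subset_of_card_le hAB (by omega)]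
  | succ n ih =>
    intro B hAB hBA hcard
    have hne : (B \ A₀).Nonempty := by
      rw [← Finset.card_pos, Finset.card_sdiff_of_subset hAB]
      omega
    -- A vertex of largest rank is placed last: it has at most one neighbor in `B`, so a fresh
    -- neighbor of the image of that vertex suffices.
    obtain ⟨v, hv, hmax⟩ := Finset.exists_max_image (B \ A₀) ρ hne
    rw [Finset.mem_sdiff] at hv
    have hcard' : (B.erase v).card = A₀.card + n := by
      rw [Finset.card_erase_of_mem hv.1]; omega
    obtain ⟨φ, hinj, hadj⟩ := ih (B.erase v)
      (fun a ha => Finset.mem_erase.2 ⟨fun h => hv.2 (h ▸ ha), hAB ha⟩)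
      ((Finset.erase_subset _ _).trans hBA) hcard'
    have hprec : ∀ u ∈ B, u ∈ A₀ ∨ ρ u ≤ ρ v := by
      intro u hu
      by_cases h : u ∈ A₀
      · exact Or.inl h
      · exact Or.inr (hmax u (Finset.mem_sdiff.2 ⟨hu, h⟩))
    have hsmall : ((B.erase v).image φ).card ≤ A.card :=
      Finset.card_image_le.trans ((Finset.card_le_card (Finset.erase_subset _ _)).trans
        (Finset.card_le_card hBA))
    obtain ⟨d, hd, hdu⟩ : ∃ d ∉ (B.erase v).image φ, ∀ u ∈ B, H.Adj v u → G.Adj d (φ u) := by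
      by_cases hex : ∃ u ∈ B, H.Adj v u
      · obtain ⟨u, hu, hvu⟩ := hex
        obtain ⟨d, hd, hud⟩ := hdeg (φ u) _ hsmall
        refine ⟨d, hd, fun u' hu' hvu' => ?_⟩
        rw [huniq v hv.2 u' u hvu' hvu (hprec u' hu') (hprec u hu)]
        exact hud.symm
      · obtain ⟨d, hd, -⟩ := hdeg (Classical.arbitrary V) _ hsmall
        exact ⟨d, hd, fun u hu hvu => absurd ⟨u, hu, hvu⟩ hex⟩
    have hd' : ∀ u ∈ B, u ≠ v → φ u ≠ d := fun u hu huv h =>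
      hd (Finset.mem_image.2 ⟨u, Finset.mem_erase.2 ⟨huv, hu⟩, h⟩)
    refine ⟨Function.update φ v d, ?_, ?_⟩
    · intro a ha b hb hab
      rw [Finset.mem_coe] at ha hb
      by_cases hav : a = v <;> by_cases hbv : b = v
      · rw [hav, hbv]
      · subst hav
        rw [Function.update_self, Function.update_of_ne hbv] at hab
        exact absurd hab.symm (hd' b hb hbv)
      · subst hbv
        rw [Function.update_self, Function.update_of_ne hav] at hab
        exact absurd hab (hd' a ha hav)
      · rw [Function.update_of_ne hav, Function.update_of_ne hbv] at hab
        exact hinj (by simp [hav, ha]) (by simp [hbv, hb]) hab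
    · intro a ha b hb hab
      by_cases hav : a = v <;> by_cases hbv : b = v
      · rw [hav, hbv] at hab; exact absurd hab H.irrefl
      · subst hav
        rw [Function.update_self, Function.update_of_ne hbv]
        exact hdu b hb hab
      · subst hbv
        rw [Function.update_self, Function.update_of_ne hav]
        exact (hdu a ha hab.symm).symm
      · rw [Function.update_of_ne hav, Function.update_of_ne hbv]
        exact hadj a (by simp [hav, ha]) b (by simp [hbv, hb]) hab

end ContainsOn

/-! ### Sparse sets in graphs of diameter two -/

section Sparse

variable {V : Type*} {G : SimpleGraph V} {Q : Finset V} {D : ℕ}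

open Classical in
/-- Every vertex of `G` has fewer than `D` neighbors in `Q`. -/
def SparseSet (G : SimpleGraph V) (Q : Finset V) (D : ℕ) : Prop :=
  ∀ v, (Q.filter (G.Adj v)).card < D

/-- Each `s ∈ S` excludes at most `D` vertices of `R`: itself and fewer than `D` neighbors. -/
theorem SparseSet.exists_avoid (h : SparseSet G Q D) {R S : Finset V} (hR : R ⊆ Q)
    (hcard : S.card * D < R.card) : ∃ r ∈ R, r ∉ S ∧ ∀ s ∈ S, ¬ G.Adj s r := by
  classical
  by_contra hcon
  push Not at hcon
  have hsub : R ⊆ S.biUnion fun s => insert s (Q.filter (G.Adj s)) := by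
    intro r hr
    rw [Finset.mem_biUnion]
    by_cases hrS : r ∈ S
    · exact ⟨r, hrS, Finset.mem_insert_self _ _⟩
    · obtain ⟨s, hs, hsr⟩ := hcon r hr hrS
      exact ⟨s, hs, Finset.mem_insert_of_mem (Finset.mem_filter.2 ⟨hR hr, hsr⟩)⟩
  have h1 := (Finset.card_le_card hsub).trans (Finset.card_biUnion_le_card_mul S _ D fun s _ =>
    (Finset.card_insert_le _ _).trans (h s))
  omega

/-- Extending a path by two edges to a vertex of `R`. -/
theorem SparseSet.exists_two_step (h : SparseSet G Q D) (hdiam : G.ediam ≤ 2) {R S : Finset V}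
    (hR : R ⊆ Q) (hcard : S.card * D < R.card) {v : V} (hv : v ∈ S) :
    ∃ r ∈ R, ∃ c, r ∉ S ∧ c ∉ S ∧ (∀ s ∈ S, ¬ G.Adj s r) ∧ G.Adj v c ∧ G.Adj c r := by
  obtain ⟨r, hr, hrS, hadj⟩ := h.exists_avoid hR hcard
  obtain ⟨c, h1, h2⟩ := exists_common_adj_of_ediam_le_two hdiam
    (fun h : v = r => hrS (h ▸ hv)) (hadj v hv)
  -- The middle vertex is automatically new: it is adjacent to `r`, and no vertex of `S` is.
  exact ⟨r, hr, c, hrS, fun hc => hadj c hc h2, hadj, h1, h2⟩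

theorem SparseSet.exists_adj_notMem (h : SparseSet G Q D) (hdiam : G.ediam ≤ 2) (v : V)
    {S : Finset V} (hcard : (S.card + 1) * D < Q.card) : ∃ d ∉ S, G.Adj v d := by
  classical
  obtain ⟨r, -, c, -, hc, -, h1, -⟩ := h.exists_two_step hdiam (S := insert v S) subset_rfl
    ((Nat.mul_le_mul_right D (Finset.card_insert_le _ _)).trans_lt hcard)
    (Finset.mem_insert_self _ _)
  exact ⟨c, fun h => hc (Finset.mem_insert_of_mem h), h1⟩

theorem SparseSet.exists_path (h : SparseSet G Q D) (hdiam : G.ediam ≤ 2) {R : Finset V}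
    (hR : R ⊆ Q) (w : V) (m : ℕ) (hcard : (2 * m + 1) * D < R.card) :
    ∃ f : ℕ → V, f 0 = w ∧ Set.InjOn f (Set.Iic (2 * m)) ∧
      (∀ i < 2 * m, G.Adj (f i) (f (i + 1))) ∧ (1 ≤ m → f (2 * m) ∈ R) := by
  classical
  induction m with
  | zero => exact ⟨fun _ => w, rfl, by intro i hi j hj _; simp_all, by simp, by simp⟩
  | succ m ih =>
    have hle : (2 * m + 1) * D ≤ (2 * (m + 1) + 1) * D := Nat.mul_le_mul_right D (by omega)
    obtain ⟨f, h0, hinj, hadj, -⟩ := ih (by omega)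
    have hS : ((Finset.range (2 * m + 1)).image f).card ≤ 2 * m + 1 :=
      Finset.card_image_le.trans (by simp)
    obtain ⟨r, hr, c, hrS, hcS, -, h1, h2⟩ := h.exists_two_step hdiam hR
      (S := (Finset.range (2 * m + 1)).image f) (v := f (2 * m))
      (by have := Nat.mul_le_mul_right D hS; omega)
      (Finset.mem_image_of_mem _ (by simp))
    have hrf : ∀ i ≤ 2 * m, f i ≠ r := fun i hi h =>
      hrS (Finset.mem_image.2 ⟨i, by simp; omega, h⟩)
    have hcf : ∀ i ≤ 2 * m, f i ≠ c := fun i hi h =>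
      hcS (Finset.mem_image.2 ⟨i, by simp; omega, h⟩)
    refine ⟨fun i => if i ≤ 2 * m then f i else if i = 2 * m + 1 then c else r, by simp [h0],
      ?_, ?_, fun _ => ?_⟩
    · intro i hi j hj hij
      simp only [Set.mem_Iic] at hi hj
      have hcr := h2.ne
      by_cases hi1 : i ≤ 2 * m <;> by_cases hj1 : j ≤ 2 * m
      · simp only [hi1, hj1, if_true] at hij
        exact hinj hi1 hj1 hij
      · simp only [hi1, hj1, if_true, if_false] at hij
        split_ifs at hij
        · exact absurd hij (hcf i hi1)
        · exact absurd hij (hrf i hi1)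
      · simp only [hi1, hj1, if_true, if_false] at hij
        split_ifs at hij
        · exact absurd hij.symm (hcf j hj1)
        · exact absurd hij.symm (hrf j hj1)
      · simp only [hi1, hj1, if_false] at hij
        split_ifs at hij
        · omega
        · exact absurd hij hcr
        · exact absurd hij.symm hcr
        · omega
    · intro i hi
      beta_reduce
      by_cases hi1 : i < 2 * m
      · rw [if_pos (by omega), if_pos (by omega)]
        exact hadj i hi1
      · by_cases hi2 : i = 2 * m
        · subst hi2
          rw [if_pos le_rfl, if_neg (by omega), if_pos rfl]
          exact h1
        · rw [if_neg (by omega), if_pos (by omega), if_neg (by omega), if_neg (by omega)]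
          exact h2
    · beta_reduce
      rw [if_neg (by omega), if_neg (by omega)]
      exact hr

-- Double counting of the pairs `(q, r)` with `c q` adjacent to `r`: there are at most `D * R.card`,
-- so at most half of the `r` occur in `2 * D` or more.
open Classical in
theorem SparseSet.card_filter_adj_le (h : SparseSet G Q D) (hD : 0 < D) {R : Finset V}
    (hR : R ⊆ Q) (c : V → V) :
    R.card ≤ 2 * (R.filter fun r => (R.filter fun q => G.Adj (c q) r).card < 2 * D).card := by
  set good := R.filter fun r => (R.filter fun q => G.Adj (c q) r).card < 2 * D with hgood
  set bad := R.filter fun r => ¬ (R.filter fun q => G.Adj (c q) r).card < 2 * D with hbad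
  have hsplit : good.card + bad.card = R.card := Finset.card_filter_add_card_filter_not _
  have h1 : ∑ r ∈ R, (R.filter fun q => G.Adj (c q) r).card =
      ∑ q ∈ R, (R.filter fun r => G.Adj (c q) r).card := by
    simp only [Finset.card_filter]
    exact Finset.sum_comm
  have h2 : ∑ q ∈ R, (R.filter fun r => G.Adj (c q) r).card ≤ ∑ _q ∈ R, D :=
    Finset.sum_le_sum fun q _ =>
      ((Finset.card_le_card (Finset.filter_subset_filter _ hR)).trans_lt (h (c q))).le
  have h3 : ∑ _r ∈ bad, 2 * D ≤ ∑ r ∈ R, (R.filter fun q => G.Adj (c q) r).card := by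
    refine (Finset.sum_le_sum fun r hr => ?_).trans
      (Finset.sum_le_sum_of_subset (Finset.filter_subset _ _))
    exact not_lt.1 (Finset.mem_filter.1 hr).2
  rw [Finset.sum_const, smul_eq_mul] at h2 h3
  have h4 : (bad.card * 2) * D ≤ R.card * D := by
    rw [mul_assoc]; omega
  have := Nat.le_of_mul_le_mul_right h4 hD
  omega

/-- A long even cycle through a prescribed vertex. -/
theorem SparseSet.exists_cycle (h : SparseSet G Q D) (hdiam : G.ediam ≤ 2) {e : ℕ} (he : 1 ≤ e)
    (w : V) (hcard : (4 * e + 6) * D < Q.card) :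
    ∃ f : ℕ → V, Set.InjOn f (Set.Iic (2 * e + 3)) ∧
      (∀ i < 2 * e + 3, G.Adj (f i) (f (i + 1))) ∧ G.Adj (f 0) (f (2 * e + 3)) := by
  classical
  have hD : 0 < D := (Nat.zero_le _).trans_lt (h w)
  -- Outside `w` and its neighbors, every `q` has a common neighbor `c q` with `w`. The cycle will
  -- be `w`, a path of length `2e` to a good vertex, then `d`, `r`, `c r`.
  set R := Q.filter fun q => ¬ (q = w ∨ G.Adj w q) with hRdef
  have hRQ : R ⊆ Q := Finset.filter_subset _ _
  have hRcard : Q.card ≤ R.card + D := by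
    have h1 : (Q.filter fun q => (q = w ∨ G.Adj w q)).card + R.card = Q.card :=
      Finset.card_filter_add_card_filter_not _
    have h2 : (Q.filter fun q => (q = w ∨ G.Adj w q)) ⊆ insert w (Q.filter (G.Adj w)) := by
      intro q hq
      rw [Finset.mem_filter] at hq
      rcases hq.2 with h3 | h3
      · exact h3 ▸ Finset.mem_insert_self _ _
      · exact Finset.mem_insert_of_mem (Finset.mem_filter.2 ⟨hq.1, h3⟩)
    have h3 := (Finset.card_le_card h2).trans (Finset.card_insert_le _ _)
    have h4 := h w
    omega
  have hex : ∀ q, ∃ c, q ∈ R → G.Adj w c ∧ G.Adj c q := by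
    intro q
    by_cases hq : q ∈ R
    · obtain ⟨hq1, hq2⟩ := Finset.mem_filter.1 hq
      push Not at hq2
      obtain ⟨c, hc⟩ := exists_common_adj_of_ediam_le_two hdiam hq2.1.symm hq2.2
      exact ⟨c, fun _ => hc⟩
    · exact ⟨w, fun h => absurd h hq⟩
  choose c hc using hex
  have hgood := h.card_filter_adj_le hD hRQ c
  set good := R.filter fun r => (R.filter fun q => G.Adj (c q) r).card < 2 * D with hgooddef
  have hmul : (4 * e + 6) * D = 2 * ((2 * e + 1) * D) + 4 * D := by ring
  have hgcard : (2 * e + 1) * D < good.card := by omega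
  obtain ⟨f, h0, hinj, hadj, hend⟩ := h.exists_path hdiam
    ((Finset.filter_subset _ _).trans hRQ : good ⊆ Q) w e hgcard
  have hr1 := (Finset.mem_filter.1 (hend he)).2
  -- Taking `r` from `R'` ensures `c r ≠ d`, as `d` is adjacent to `f (2 * e)`. Goodness of `f (2 *
  -- e)` keeps `R'` large.
  set R' := R.filter fun q => ¬ G.Adj (c q) (f (2 * e)) with hR'
  have hR'card : (R.filter fun q => G.Adj (c q) (f (2 * e))).card + R'.card = R.card :=
    Finset.card_filter_add_card_filter_not _
  have hS : ((Finset.range (2 * e + 1)).image f).card ≤ 2 * e + 1 :=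
    Finset.card_image_le.trans (by simp)
  have hScard : ((Finset.range (2 * e + 1)).image f).card * D < R'.card := by
    have := Nat.mul_le_mul_right D hS
    omega
  obtain ⟨r, hr, d, hrS, hdS, hSr, h1, h2⟩ := h.exists_two_step hdiam
    ((Finset.filter_subset _ _).trans hRQ : R' ⊆ Q)
    (S := (Finset.range (2 * e + 1)).image f) (v := f (2 * e)) hScard
    (Finset.mem_image_of_mem _ (by simp))
  obtain ⟨hrR, hcr⟩ := Finset.mem_filter.1 hr
  obtain ⟨hwc, hcr'⟩ := hc r hrR
  have hrf : ∀ i ≤ 2 * e, f i ≠ r := fun i hi h =>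
    hrS (Finset.mem_image.2 ⟨i, by simp; omega, h⟩)
  have hdf : ∀ i ≤ 2 * e, f i ≠ d := fun i hi h =>
    hdS (Finset.mem_image.2 ⟨i, by simp; omega, h⟩)
  have hcf : ∀ i ≤ 2 * e, f i ≠ c r := fun i hi h =>
    hSr (f i) (Finset.mem_image.2 ⟨i, by simp; omega, rfl⟩) (h ▸ hcr')
  have hdr : d ≠ r := h2.ne
  have hcr2 : c r ≠ r := hcr'.ne
  have hcd : c r ≠ d := fun h => hcr (h ▸ h1.symm)
  set f' : ℕ → V := fun i => if i ≤ 2 * e then f i else if i = 2 * e + 1 then d else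
    if i = 2 * e + 2 then r else c r with hf'
  have e1 : ∀ i ≤ 2 * e, f' i = f i := fun i hi => if_pos hi
  have e2 : f' (2 * e + 1) = d := by simp [hf']
  have e3 : f' (2 * e + 2) = r := by simp [hf']
  have e4 : f' (2 * e + 3) = c r := by simp [hf']
  refine ⟨f', ?_, ?_, ?_⟩
  · intro i hi j hj hij
    simp only [Set.mem_Iic] at hi hj
    have hi' : i ≤ 2 * e ∨ i = 2 * e + 1 ∨ i = 2 * e + 2 ∨ i = 2 * e + 3 := by omega
    have hj' : j ≤ 2 * e ∨ j = 2 * e + 1 ∨ j = 2 * e + 2 ∨ j = 2 * e + 3 := by omega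
    rcases hi' with hi' | rfl | rfl | rfl <;> rcases hj' with hj' | rfl | rfl | rfl <;>
      try simp only [e2, e3, e4] at hij
    all_goals try rw [e1 i hi'] at hij
    all_goals try rw [e1 j hj'] at hij
    all_goals first
      | rfl
      | exact hinj hi' hj' hij
      | exact absurd hij (hdf _ ‹_›)
      | exact absurd hij (hrf _ ‹_›)
      | exact absurd hij (hcf _ ‹_›)
      | exact absurd hij.symm (hdf _ ‹_›)
      | exact absurd hij.symm (hrf _ ‹_›)
      | exact absurd hij.symm (hcf _ ‹_›)
      | exact absurd hij ‹_›
      | exact absurd hij.symm ‹_›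
  · intro i hi
    have hi' : i < 2 * e ∨ i = 2 * e ∨ i = 2 * e + 1 ∨ i = 2 * e + 2 := by omega
    rcases hi' with hi' | rfl | rfl | rfl
    · rw [e1 i hi'.le, e1 (i + 1) hi']
      exact hadj i hi'
    · rw [e1 _ le_rfl, e2]
      exact h1
    · rw [e2, e3]
      exact h2
    · rw [e3, e4]
      exact hcr'.symm
  · rw [e1 0 (Nat.zero_le _), h0, e4]
    exact hwc

end Sparse

/-! ### Embedding the pattern when a sparse set exists -/

section ApexBox

variable {V : Type*} {G : SimpleGraph V}

/-- The apex together with the central parts of the first `r` paths of `apexPattern`. -/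
noncomputable def apexBox (r L : ℕ) : Finset (Option (ℕ × ℤ)) :=
  Finset.insertNone (Finset.range r ×ˢ Finset.Icc (-(L : ℤ)) L)

/-- The cycle of `apexPattern e`. -/
noncomputable def apexCycle (e : ℕ) : Finset (Option (ℕ × ℤ)) :=
  Finset.insertNone ({0} ×ˢ Finset.Icc (0 : ℤ) (2 * e + 2))

theorem some_mem_apexBox {r L j : ℕ} {x : ℤ} :
    some (j, x) ∈ apexBox r L ↔ j < r ∧ -(L : ℤ) ≤ x ∧ x ≤ L := by
  simp [apexBox]

theorem some_mem_apexCycle {e j : ℕ} {x : ℤ} :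
    some (j, x) ∈ apexCycle e ↔ j = 0 ∧ 0 ≤ x ∧ x ≤ 2 * e + 2 := by
  simp only [apexCycle, Finset.some_mem_insertNone, Finset.mem_product, Finset.mem_singleton,
    Finset.mem_Icc]

theorem containsOn_apexPattern {e : ℕ} {A : Finset (Option (ℕ × ℤ))} (w : V) (f : ℕ → ℤ → V)
    (hw : ∀ j x, some (j, x) ∈ A → f j x ≠ w)
    (hinj : ∀ j x j' x', some (j, x) ∈ A → some (j', x') ∈ A → f j x = f j' x' →
      j = j' ∧ x = x')
    (hpath : ∀ j x, some (j, x) ∈ A → some (j, x + 1) ∈ A → G.Adj (f j x) (f j (x + 1)))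
    (hapex : ∀ j, some (j, 0) ∈ A → G.Adj w (f j 0))
    (hapex' : some (0, 2 * (e : ℤ) + 2) ∈ A → G.Adj w (f 0 (2 * e + 2))) :
    ContainsOn (apexPattern e) A G := by
  have hap : ∀ j x, some (j, x) ∈ A → (apexPattern e).Adj none (some (j, x)) →
      G.Adj w (f j x) := by
    intro j x hm h
    rw [apexPattern_adj_none_some] at h
    rcases h with rfl | ⟨rfl, rfl⟩
    · exact hapex j hm
    · exact hapex' hm
  refine ⟨fun o => o.elim w fun a => f a.1 a.2, ?_, ?_⟩
  · rintro (_ | ⟨j, x⟩) ha (_ | ⟨j', x'⟩) hb hab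
    · rfl
    · exact absurd hab.symm (hw j' x' hb)
    · exact absurd hab (hw j x ha)
    · obtain ⟨rfl, rfl⟩ := hinj j x j' x' ha hb hab
      rfl
  · rintro (_ | ⟨j, x⟩) ha (_ | ⟨j', x'⟩) hb hab
    · exact absurd hab (apexPattern e).irrefl
    · exact hap j' x' hb hab
    · exact (hap j x ha hab.symm).symm
    · rw [apexPattern_adj_some_some] at hab
      obtain ⟨rfl, rfl | rfl⟩ := hab
      · exact hpath j x ha hb
      · exact (hpath j x' hb ha).symm

theorem SparseSet.containsOn_apexBox {Q : Finset V} {D : ℕ} (h : SparseSet G Q D)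
    (hdiam : G.ediam ≤ 2) {e r L : ℕ} (he : 1 ≤ e) (hr : 1 ≤ r) (hL : 2 * e + 2 ≤ L)
    (hcard : (4 * e + 6 + (apexBox r L).card) * D < Q.card) :
    ContainsOn (apexPattern e) (apexBox r L) G := by
  have hQ : Q.Nonempty := Finset.card_pos.1 ((Nat.zero_le _).trans_lt hcard)
  obtain ⟨w, -⟩ := hQ
  have : Nonempty V := ⟨w⟩
  have hcore : ContainsOn (apexPattern e) (apexCycle e) G := by
    obtain ⟨f, hinj, hadj, hclose⟩ := h.exists_cycle hdiam he w
      ((Nat.mul_le_mul_right D (by omega)).trans_lt hcard)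
    -- Vertex 0 of the cycle plays the apex, and vertex `x + 1` plays position `x` of path 0.
    refine containsOn_apexPattern (f 0) (fun _ x => f (x.toNat + 1)) ?_ ?_ ?_ ?_ ?_
    · intro j x hx h
      rw [some_mem_apexCycle] at hx
      have := hinj (by simp; omega) (by simp) h
      omega
    · intro j x j' x' hx hx' h
      rw [some_mem_apexCycle] at hx hx'
      have := hinj (by simp; omega) (by simp; omega) h
      omega
    · intro j x hx hx'
      rw [some_mem_apexCycle] at hx hx'
      have := hadj (x.toNat + 1) (by omega)
      rwa [show x.toNat + 1 + 1 = (x + 1).toNat + 1 by omega] at this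
    · intro j _
      exact hadj 0 (by omega)
    · intro _
      rwa [show (2 * (e : ℤ) + 2).toNat + 1 = 2 * e + 3 by omega]
  -- The rank is the distance from the origin of the path. Off the cycle, a vertex at `x ≠ 0` is
  -- preceded only by its neighbor nearer the origin, and an origin only by the apex.
  refine hcore.extend (A := apexBox r L) (fun o => o.elim 0 fun a => a.2.natAbs) ?_ ?_
    ((apexBox r L).card - (apexCycle e).card) (apexBox r L) ?_ subset_rfl ?_
  · intro v S hS
    refine h.exists_adj_notMem hdiam v ((Nat.mul_le_mul_right D ?_).trans_lt hcard)
    omega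
  · rintro (_ | ⟨j, x⟩) hv (_ | ⟨i, y⟩) (_ | ⟨i', y'⟩) hu hu' h1 h2
    · rfl
    · exact absurd (by simp [apexCycle]) hv
    · exact absurd (by simp [apexCycle]) hv
    · exact absurd (by simp [apexCycle]) hv
    · rfl
    · rw [adj_comm, apexPattern_adj_none_some] at hu
      rw [apexPattern_adj_some_some] at hu'
      rw [some_mem_apexCycle] at hv h2
      simp only [Option.elim] at h2
      omega
    · rw [adj_comm, apexPattern_adj_none_some] at hu'
      rw [apexPattern_adj_some_some] at hu
      rw [some_mem_apexCycle] at hv h1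
      simp only [Option.elim] at h1
      omega
    · rw [apexPattern_adj_some_some] at hu hu'
      rw [some_mem_apexCycle] at hv h1 h2
      simp only [Option.elim] at h1 h2
      have : i = i' ∧ y = y' := by omega
      rw [this.1, this.2]
  · rintro (_ | ⟨j, x⟩) hm
    · simp [apexBox]
    · rw [some_mem_apexCycle] at hm
      rw [some_mem_apexBox]
      omega
  · refine (Nat.add_sub_cancel' (Finset.card_le_card ?_)).symm
    rintro (_ | ⟨j, x⟩) hm
    · simp [apexBox]
    · rw [some_mem_apexCycle] at hm
      rw [some_mem_apexBox]
      omega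

end ApexBox

/-! ### Embedding the pattern along disjoint paths with hubs -/

section DisjointPaths

variable {V : Type*} {G : SimpleGraph V} {q : ℕ → ℤ → V} {K : ℕ} {I : Finset ℕ}

/-- The paths `q i (-K), …, q i K` of `G`, for `i ∈ I`, are disjoint. -/
structure DisjointPaths (G : SimpleGraph V) (q : ℕ → ℤ → V) (K : ℕ) (I : Finset ℕ) : Prop where
  inj : ∀ i ∈ I, ∀ j ∈ I, ∀ x y : ℤ, -(K : ℤ) ≤ x → x ≤ K → -(K : ℤ) ≤ y → y ≤ K →
    q i x = q j y → i = j ∧ x = y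
  adj : ∀ i ∈ I, ∀ x : ℤ, -(K : ℤ) ≤ x → x < K → G.Adj (q i x) (q i (x + 1))

theorem DisjointPaths.mono (h : DisjointPaths G q K I) {J : Finset ℕ} (hJ : J ⊆ I) :
    DisjointPaths G q K J :=
  ⟨fun i hi j hj => h.inj i (hJ hi) j (hJ hj), fun i hi => h.adj i (hJ hi)⟩

theorem DisjointPaths.exists_avoid (h : DisjointPaths G q K I) (v : V) :
    ∃ J ⊆ I, I.card ≤ J.card + 1 ∧
      ∀ i ∈ J, ∀ x : ℤ, -(K : ℤ) ≤ x → x ≤ K → q i x ≠ v := by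
  by_cases hex : ∃ i ∈ I, ∃ x : ℤ, -(K : ℤ) ≤ x ∧ x ≤ K ∧ q i x = v
  · obtain ⟨i, hi, x, hx, hx', rfl⟩ := hex
    refine ⟨I.erase i, Finset.erase_subset _ _, by rw [Finset.card_erase_of_mem hi]; omega,
      fun j hj y hy hy' heq => ?_⟩
    rw [Finset.mem_erase] at hj
    exact hj.1 (h.inj j hj.2 i hi y x hy hy' hx hx' heq).1
  · exact ⟨I, subset_rfl, Nat.le_succ _, fun i hi x hx hx' heq => hex ⟨i, hi, x, hx, hx', heq⟩⟩

theorem exists_injOn_of_le_card {J : Finset ℕ} {r : ℕ} (h : r ≤ J.card) :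
    ∃ f : ℕ → ℕ, (∀ j < r, f j ∈ J) ∧ Set.InjOn f (Set.Iio r) := by
  refine ⟨fun j => if h : j < J.card then J.equivFin.symm ⟨j, h⟩ else 0, fun j hj => ?_,
    fun i hi j hj hij => ?_⟩
  · beta_reduce
    rw [dif_pos (by omega)]
    exact Subtype.coe_prop _
  · simp only [Set.mem_Iio] at hi hj
    simp only [hi.trans_le h, hj.trans_le h, dite_true] at hij
    have := J.equivFin.symm.injective (Subtype.ext hij)
    simpa using this

/-- Adding paths whose vertex `t` is adjacent to the apex to a path `s` with two vertices that are
adjacent to the apex. -/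
theorem DisjointPaths.containsOn_of_special (h : DisjointPaths G q K I) {e r L : ℕ} {w : V}
    (s : ℤ → V) {t : ℤ} (hcard : r ≤ I.card) (ht : -(K : ℤ) + L ≤ t) (ht' : t + L ≤ K)
    (hs : ∀ x y : ℤ, -(L : ℤ) ≤ x → x ≤ L → -(L : ℤ) ≤ y → y ≤ L → s x = s y → x = y)
    (hsadj : ∀ x : ℤ, -(L : ℤ) ≤ x → x < L → G.Adj (s x) (s (x + 1)))
    (hsw : ∀ x : ℤ, -(L : ℤ) ≤ x → x ≤ L → s x ≠ w)
    (hs0 : G.Adj w (s 0)) (hs1 : G.Adj w (s (2 * e + 2)))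
    (hqw : ∀ i ∈ I, ∀ x : ℤ, -(K : ℤ) ≤ x → x ≤ K → q i x ≠ w)
    (hqs : ∀ i ∈ I, ∀ x y : ℤ, -(K : ℤ) ≤ x → x ≤ K → -(L : ℤ) ≤ y → y ≤ L → q i x ≠ s y)
    (hq : ∀ i ∈ I, G.Adj w (q i t)) :
    ContainsOn (apexPattern e) (apexBox r L) G := by
  obtain ⟨f, hfI, hf⟩ := exists_injOn_of_le_card hcard
  refine containsOn_apexPattern w (fun j x => if j = 0 then s x else q (f j) (t + x))
    ?_ ?_ ?_ ?_ ?_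
  · intro j x hjx
    obtain ⟨hj, hx, hx'⟩ := some_mem_apexBox.1 hjx
    split_ifs with hj0
    · exact hsw x hx hx'
    · exact hqw _ (hfI j hj) _ (by omega) (by omega)
  · intro j x j' x' hjx hjx' heq
    obtain ⟨hj, hx, hx1⟩ := some_mem_apexBox.1 hjx
    obtain ⟨hj', hx', hx1'⟩ := some_mem_apexBox.1 hjx'
    beta_reduce at heq
    split_ifs at heq with h1 h2 h2
    · exact ⟨by omega, hs x x' hx hx1 hx' hx1' heq⟩
    · exact absurd heq.symm (hqs _ (hfI j' hj') _ _ (by omega) (by omega) hx hx1)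
    · exact absurd heq (hqs _ (hfI j hj) _ _ (by omega) (by omega) hx' hx1')
    · obtain ⟨h3, h4⟩ := h.inj _ (hfI j hj) _ (hfI j' hj') _ _ (by omega) (by omega) (by omega)
        (by omega) heq
      exact ⟨hf hj hj' h3, by omega⟩
  · intro j x hjx hjx'
    obtain ⟨hj, hx, hx1⟩ := some_mem_apexBox.1 hjx
    obtain ⟨-, hx', hx1'⟩ := some_mem_apexBox.1 hjx'
    split_ifs with hj0
    · exact hsadj x hx (by omega)
    · rw [← add_assoc]
      exact h.adj _ (hfI j hj) _ (by omega) (by omega)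
  · intro j hjx
    obtain ⟨hj, -, -⟩ := some_mem_apexBox.1 hjx
    split_ifs with hj0
    · exact hs0
    · rw [add_zero]
      exact hq _ (hfI j hj)
  · intro _
    exact hs1

/-- One of the paths itself serves as the special path. The two spare indices pay for it and for a
path that may contain `w`. -/
theorem DisjointPaths.containsOn_of_adj_adj (h : DisjointPaths G q K I) {e r L : ℕ} {w : V}
    (hcard : r + 2 ≤ I.card) (hK : L ≤ K)
    (h0 : ∀ i ∈ I, G.Adj w (q i 0)) (h1 : ∀ i ∈ I, G.Adj w (q i (2 * e + 2))) :
    ContainsOn (apexPattern e) (apexBox r L) G := by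
  obtain ⟨J, hJI, hJcard, hJw⟩ := h.exists_avoid w
  obtain ⟨i, hi⟩ : J.Nonempty := Finset.card_pos.1 (by omega)
  have hsub : J.erase i ⊆ I := (Finset.erase_subset _ _).trans hJI
  refine (h.mono hsub).containsOn_of_special (w := w) (q i) (t := 0) ?_ (by omega) (by omega)
    ?_ ?_ ?_ (h0 i (hJI hi)) (h1 i (hJI hi)) ?_ ?_ ?_
  · rw [Finset.card_erase_of_mem hi]; omega
  · intro x y hx hx' hy hy' heq
    exact (h.inj i (hJI hi) i (hJI hi) x y (by omega) (by omega) (by omega) (by omega) heq).2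
  · intro x hx hx'
    exact h.adj i (hJI hi) x (by omega) (by omega)
  · intro x hx hx'
    exact hJw i hi x (by omega) (by omega)
  · intro j hj x hx hx'
    exact hJw j (Finset.mem_of_mem_erase hj) x hx hx'
  · intro j hj x y hx hx' hy hy' heq
    exact Finset.ne_of_mem_erase hj
      (h.inj j (hsub hj) i (hJI hi) x y hx hx' (by omega) (by omega) heq).1
  · intro j hj
    exact h0 j (hsub hj)

-- The special path runs along path `i` to position `u`, through `w'`, and away from position `u` on
-- path `j`. Its vertices at `0` and `2e + 2` are `q i (u - a)` and `q j (g b)`, because `a + 2 + b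
-- = 2e + 2`; beyond them it continues on the same two paths.
open Classical in
theorem DisjointPaths.containsOn_of_two_hubs (h : DisjointPaths G q K I) {e r L : ℕ} {w w' : V}
    {u : ℤ} {a b : ℕ} {g : ℤ → ℤ} (hg : (∀ y, g y = u + y) ∨ ∀ y, g y = u - y)
    (hab : a + b = 2 * e) (hu : 0 ≤ u) (hu' : u ≤ 2 * e + 2)
    (hcard : r + 4 ≤ I.card) (hL : 2 * e + 2 ≤ L) (hK : L + 4 * e + 4 ≤ K)
    (hw : ∀ i ∈ I, ¬ G.Adj w (q i u)) (hwa : ∀ i ∈ I, G.Adj w (q i (u - a)))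
    (hwb : ∀ i ∈ I, G.Adj w (q i (g b)))
    (hw' : 4 ≤ (I.filter fun i => G.Adj w' (q i u)).card) :
    ContainsOn (apexPattern e) (apexBox r L) G := by
  obtain ⟨J₁, hJ₁, hJ₁card, hJ₁w⟩ := h.exists_avoid w
  obtain ⟨J, hJJ₁, hJcard, hJw'⟩ := (h.mono hJ₁).exists_avoid w'
  have hJI : J ⊆ I := hJJ₁.trans hJ₁
  have hJw : ∀ i ∈ J, ∀ x : ℤ, -(K : ℤ) ≤ x → x ≤ K → q i x ≠ w := fun i hi => hJ₁w i (hJJ₁ hi)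
  -- At most two of the four indices are lost to paths containing `w` or `w'`.
  obtain ⟨i, hi, j, hj, hij⟩ : ∃ i ∈ J.filter (fun i => G.Adj w' (q i u)),
      ∃ j ∈ J.filter (fun i => G.Adj w' (q i u)), i ≠ j := by
    apply Finset.one_lt_card.1
    have h1 : I.filter (fun i => G.Adj w' (q i u)) ⊆
        J.filter (fun i => G.Adj w' (q i u)) ∪ (I \ J) := by
      intro x hx
      simp only [Finset.mem_filter, Finset.mem_union, Finset.mem_sdiff] at hx ⊢
      tauto
    have h2 := (Finset.card_le_card h1).trans (Finset.card_union_le _ _)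
    rw [Finset.card_sdiff_of_subset hJI] at h2
    omega
  obtain ⟨hi, hwi⟩ := Finset.mem_filter.1 hi
  obtain ⟨hj, hwj⟩ := Finset.mem_filter.1 hj
  have hne : w' ≠ w := fun heq => hw i (hJI hi) (heq ▸ hwi)
  have hg0 : g 0 = u := by rcases hg with hg | hg <;> simp [hg]
  have hgr : ∀ x : ℤ, 0 ≤ x → x ≤ L → -(K : ℤ) ≤ g x ∧ g x ≤ K := by
    intro x hx hx'
    rcases hg with hg | hg <;> rw [hg] <;> omega
  have hginj : ∀ x y : ℤ, g x = g y → x = y := by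
    intro x y
    rcases hg with hg | hg <;> rw [hg, hg] <;> omega
  have hgadj : ∀ x : ℤ, 0 ≤ x → x < L → G.Adj (q j (g x)) (q j (g (x + 1))) := by
    intro x hx hx'
    have h1 := hgr x hx hx'.le
    have h2 := hgr (x + 1) (by omega) (by omega)
    rcases hg with hg | hg
    · have := h.adj j (hJI hj) (g x) (by omega) (by rw [hg] at h2 ⊢; omega)
      rwa [show g x + 1 = g (x + 1) by rw [hg, hg]; ring] at this
    · have := h.adj j (hJI hj) (g (x + 1)) (by omega) (by rw [hg] at h1 ⊢; omega)
      rw [show g (x + 1) + 1 = g x by rw [hg, hg]; ring] at this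
      exact this.symm
  set s : ℤ → V := fun x => if x ≤ a then q i (u - a + x) else if x = a + 1 then w' else
    q j (g (x - a - 2)) with hs
  have s1 : ∀ x : ℤ, x ≤ a → s x = q i (u - a + x) := fun x hx => if_pos hx
  have s2 : s (a + 1) = w' := by simp [hs]
  have s3 : ∀ x : ℤ, (a : ℤ) + 2 ≤ x → s x = q j (g (x - a - 2)) := by
    intro x hx
    rw [hs]
    beta_reduce
    rw [if_neg (by omega), if_neg (by omega)]
  have tri : ∀ x : ℤ, x ≤ a ∨ x = a + 1 ∨ (a : ℤ) + 2 ≤ x := by intro x; omega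
  have hsub : (J.erase i).erase j ⊆ J := (Finset.erase_subset _ _).trans (Finset.erase_subset _ _)
  refine (h.mono (hsub.trans hJI)).containsOn_of_special (w := w) s (t := u - a) ?_ (by omega)
    (by omega) ?_ ?_ ?_ ?_ ?_ ?_ ?_ ?_
  · rw [Finset.card_erase_of_mem (Finset.mem_erase.2 ⟨hij.symm, hj⟩),
      Finset.card_erase_of_mem hi]
    omega
  · intro x y hx hx' hy hy' heq
    rcases tri x with h1 | rfl | h1 <;> rcases tri y with h2 | rfl | h2
    · rw [s1 x h1, s1 y h2] at heq
      have := (h.inj i (hJI hi) i (hJI hi) _ _ (by omega) (by omega) (by omega) (by omega) heq).2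
      omega
    · rw [s1 x h1, s2] at heq
      exact absurd heq (hJw' i hi _ (by omega) (by omega))
    · rw [s1 x h1, s3 y h2] at heq
      have h3 := hgr (y - a - 2) (by omega) (by omega)
      exact absurd (h.inj i (hJI hi) j (hJI hj) _ _ (by omega) (by omega) h3.1 h3.2 heq).1 hij
    · rw [s2, s1 y h2] at heq
      exact absurd heq.symm (hJw' i hi _ (by omega) (by omega))
    · rfl
    · rw [s2, s3 y h2] at heq
      have h3 := hgr (y - a - 2) (by omega) (by omega)
      exact absurd heq.symm (hJw' j hj _ h3.1 h3.2)
    · rw [s3 x h1, s1 y h2] at heq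
      have h3 := hgr (x - a - 2) (by omega) (by omega)
      exact absurd (h.inj j (hJI hj) i (hJI hi) _ _ h3.1 h3.2 (by omega) (by omega) heq).1 hij.symm
    · rw [s2, s3 x h1] at heq
      have h3 := hgr (x - a - 2) (by omega) (by omega)
      exact absurd heq (hJw' j hj _ h3.1 h3.2)
    · rw [s3 x h1, s3 y h2] at heq
      have h3 := hgr (x - a - 2) (by omega) (by omega)
      have h4 := hgr (y - a - 2) (by omega) (by omega)
      have := hginj _ _ (h.inj j (hJI hj) j (hJI hj) _ _ h3.1 h3.2 h4.1 h4.2 heq).2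
      omega
  · intro x hx hx'
    have hx4 : x < a ∨ x = a ∨ x = a + 1 ∨ (a : ℤ) + 2 ≤ x := by omega
    rcases hx4 with h1 | rfl | rfl | h1
    · rw [s1 x h1.le, s1 (x + 1) (by omega), ← add_assoc]
      exact h.adj i (hJI hi) _ (by omega) (by omega)
    · rw [s1 _ le_rfl, s2, sub_add_cancel]
      exact hwi.symm
    · rw [s2, s3 _ (by omega), show (a : ℤ) + 1 + 1 - a - 2 = 0 by ring, hg0]
      exact hwj
    · rw [s3 x h1, s3 (x + 1) (by omega), show x + 1 - a - 2 = x - a - 2 + 1 by ring]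
      exact hgadj _ (by omega) (by omega)
  · intro x hx hx'
    rcases tri x with h1 | rfl | h1
    · rw [s1 x h1]
      exact hJw i hi _ (by omega) (by omega)
    · rwa [s2]
    · rw [s3 x h1]
      have h3 := hgr (x - a - 2) (by omega) (by omega)
      exact hJw j hj _ h3.1 h3.2
  · rw [s1 0 (by omega), add_zero]
    exact hwa i (hJI hi)
  · rw [s3 _ (by omega), show 2 * (e : ℤ) + 2 - a - 2 = b by omega]
    exact hwb j (hJI hj)
  · intro l hl x hx hx'
    exact hJw l (hsub hl) x hx hx'
  · intro l hl x y hx hx' hy hy' heq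
    simp only [Finset.mem_erase] at hl
    rcases tri y with h1 | rfl | h1
    · rw [s1 y h1] at heq
      exact hl.2.1 (h.inj l (hJI hl.2.2) i (hJI hi) _ _ hx hx' (by omega) (by omega) heq).1
    · rw [s2] at heq
      exact hJw' l hl.2.2 x hx hx' heq
    · rw [s3 y h1] at heq
      have h3 := hgr (y - a - 2) (by omega) (by omega)
      exact hl.1 (h.inj l (hJI hl.2.2) j (hJI hj) _ _ hx hx' h3.1 h3.2 heq).1
  · intro l hl
    exact hwa l (hJI (hsub hl))

-- Without a hub, the vertices at position `u` form a sparse set, and the pattern is already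
-- present.
open Classical in
theorem DisjointPaths.exists_hub (h : DisjointPaths G q K I) (hdiam : G.ediam ≤ 2) {e r L : ℕ}
    (he : 1 ≤ e) (hr : 1 ≤ r) (hL : 2 * e + 2 ≤ L)
    (hG : ¬ ContainsOn (apexPattern e) (apexBox r L) G) {D : ℕ} {u : ℤ} (hu : -(K : ℤ) ≤ u)
    (hu' : u ≤ K) (hcard : (4 * e + 6 + (apexBox r L).card) * D < I.card) :
    ∃ w, D ≤ (I.filter fun i => G.Adj w (q i u)).card := by
  by_contra hcon
  push Not at hcon
  have hinj : Set.InjOn (fun i => q i u) I := fun i hi j hj hij =>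
    (h.inj i hi j hj u u hu hu' hu hu' hij).1
  refine hG (SparseSet.containsOn_apexBox (Q := I.image fun i => q i u) (D := D) (fun v => ?_)
    hdiam he hr hL ?_)
  · rw [Finset.filter_image]
    exact Finset.card_image_le.trans_lt (hcon v)
  · rwa [Finset.card_image_of_injOn hinj]

theorem DisjointPaths.containsOn_apexBox (h : DisjointPaths G q K I) (hdiam : G.ediam ≤ 2)
    {e r L : ℕ} (he : 1 ≤ e) (hr : 1 ≤ r) (hL : 2 * e + 2 ≤ L) (hK : L + 4 * e + 4 ≤ K)
    (hcard : (4 * e + 6 + (apexBox r L).card) *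
      (6 * ((4 * e + 6 + (apexBox r L).card) * 4 + r + 5)) < I.card) :
    ContainsOn (apexPattern e) (apexBox r L) G := by
  classical
  by_contra hG
  set C := 4 * e + 6 + (apexBox r L).card with hC
  set M := C * 4 + r + 5 with hM
  obtain ⟨w, hw⟩ := h.exists_hub hdiam he hr hL hG (u := 0) (by omega) (by omega) hcard
  set I₁ := I.filter fun i => G.Adj w (q i 0) with hI₁
  let A : ℤ → ℕ → Prop := fun u i => ¬ G.Adj w (q i u) ∧ G.Adj w (q i (u - e))
  -- Case 0 is adjacency at `2e + 2`. The others record the first failure in the order `e, 2e, 2, e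
  -- + 2, 2e + 2`. All except the failure at 2 come with adjacency `e` steps earlier; that one uses
  -- positions 0 and `2e` instead.
  let P : Fin 6 → ℕ → Prop := ![fun i => G.Adj w (q i (2 * e + 2)), A e, A (2 * e),
    fun i => ¬ G.Adj w (q i 2) ∧ G.Adj w (q i (2 * e)), A (e + 2), A (2 * e + 2)]
  have hP : ∀ i ∈ I₁, ∃ c, P c i := by
    intro i hi
    have h0 : G.Adj w (q i 0) := (Finset.mem_filter.1 hi).2
    by_cases h1 : G.Adj w (q i e)
    swap
    · exact ⟨1, h1, by rwa [sub_self]⟩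
    by_cases h2 : G.Adj w (q i (2 * e))
    swap
    · exact ⟨2, h2, by rwa [show 2 * (e : ℤ) - e = e by ring]⟩
    by_cases h3 : G.Adj w (q i 2)
    swap
    · exact ⟨3, h3, h2⟩
    by_cases h4 : G.Adj w (q i (e + 2))
    swap
    · exact ⟨4, h4, by rwa [show (e : ℤ) + 2 - e = 2 by ring]⟩
    by_cases h5 : G.Adj w (q i (2 * e + 2))
    · exact ⟨0, h5⟩
    · exact ⟨5, h5, by rwa [show 2 * (e : ℤ) + 2 - e = e + 2 by ring]⟩
  obtain ⟨c, hc⟩ : ∃ c, M ≤ (I₁.filter (P c)).card := by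
    by_contra hcon
    push Not at hcon
    have hsub : I₁ ⊆ Finset.univ.biUnion fun c => I₁.filter (P c) := by
      intro i hi
      obtain ⟨c, hc⟩ := hP i hi
      exact Finset.mem_biUnion.2 ⟨c, Finset.mem_univ _, Finset.mem_filter.2 ⟨hi, hc⟩⟩
    have h1 := (Finset.card_le_card hsub).trans (Finset.card_biUnion_le_card_mul _ _ (M - 1)
      fun c _ => by have := hcon c; omega)
    rw [Finset.card_univ, Fintype.card_fin] at h1
    omega
  have hsub : I₁.filter (P c) ⊆ I := (Finset.filter_subset _ _).trans (Finset.filter_subset _ _)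
  have hJ := h.mono hsub
  have hJ0 : ∀ i ∈ I₁.filter (P c), G.Adj w (q i 0) := fun i hi =>
    (Finset.mem_filter.1 (Finset.mem_filter.1 hi).1).2
  have hJP : ∀ i ∈ I₁.filter (P c), P c i := fun i hi => (Finset.mem_filter.1 hi).2
  generalize I₁.filter (P c) = J at hc hJ hJ0 hJP
  -- Both pieces run down from `u` to `u - e`, on two different paths, so `a = b = e`.
  have hA : ∀ u : ℤ, 0 ≤ u → u ≤ 2 * e + 2 → (∀ i ∈ J, A u i) → False := by
    intro u hu hu' hAu
    obtain ⟨w', hw'⟩ := hJ.exists_hub hdiam he hr hL hG (D := 4) (u := u) (by omega) (by omega)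
      (by omega)
    exact hG (hJ.containsOn_of_two_hubs (w := w) (w' := w') (u := u) (a := e) (b := e)
      (g := fun y => u - y) (Or.inr fun _ => rfl) (by omega) hu hu' (by omega) hL hK
      (fun i hi => (hAu i hi).1) (fun i hi => (hAu i hi).2) (fun i hi => (hAu i hi).2) hw')
  fin_cases c
  · exact hG (hJ.containsOn_of_adj_adj (by omega) (by omega) hJ0 hJP)
  · exact hA e (by omega) (by omega) hJP
  · exact hA (2 * e) (by omega) (by omega) hJP
  -- Here one piece joins 2 to 0 and the other joins 2 to `2e`, of lengths 2 and `2e - 2`.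
  · obtain ⟨w', hw'⟩ := hJ.exists_hub hdiam he hr hL hG (D := 4) (u := 2) (by omega) (by omega)
      (by omega)
    refine hG (hJ.containsOn_of_two_hubs (w := w) (w' := w') (u := 2) (a := 2) (b := 2 * e - 2)
      (g := fun y => 2 + y) (Or.inl fun _ => rfl) (by omega) (by omega) (by omega) (by omega) hL hK
      (fun i hi => (hJP i hi).1) (fun i hi => by simpa using hJ0 i hi) (fun i hi => ?_) hw')
    have := (hJP i hi).2
    rwa [show (2 : ℤ) + (2 * e - 2 : ℕ) = 2 * e by omega]
  · exact hA (e + 2) (by omega) (by omega) hJP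
  · exact hA (2 * e + 2) (by omega) (by omega) hJP

/-- The path is cut into blocks of `2K + 1` consecutive vertices, each indexed from its middle. -/
theorem disjointPaths_of_isPath {u v : V} {p : G.Walk u v} (hp : p.IsPath) {K M : ℕ}
    (hlen : (2 * K + 1) * M ≤ p.length) :
    DisjointPaths G (fun i x => p.getVert ((2 * K + 1) * (i : ℤ) + K + x).toNat) K
      (Finset.range M) := by
  have hpos : ∀ i ∈ Finset.range M, ∀ x : ℤ, -(K : ℤ) ≤ x → x ≤ K →
      0 ≤ (2 * K + 1) * (i : ℤ) + K + x ∧ (2 * K + 1) * (i : ℤ) + K + x < p.length := by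
    intro i hi x hx hx'
    rw [Finset.mem_range] at hi
    have h1 : (2 * (K : ℤ) + 1) * (i + 1) ≤ (2 * K + 1) * M :=
      mul_le_mul_of_nonneg_left (by exact_mod_cast hi) (by positivity)
    have h2 : (2 * (K : ℤ) + 1) * M ≤ p.length := by exact_mod_cast hlen
    have h3 : 0 ≤ (2 * (K : ℤ) + 1) * i := by positivity
    rw [mul_add] at h1
    constructor <;> linarith
  have hlt : ∀ i j : ℕ, i < j → (2 * (K : ℤ) + 1) * i + (2 * K + 1) ≤ (2 * K + 1) * j := by
    intro i j hij
    have : (2 * (K : ℤ) + 1) * (i + 1) ≤ (2 * K + 1) * j :=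
      mul_le_mul_of_nonneg_left (by exact_mod_cast hij) (by positivity)
    linarith
  constructor
  · intro i hi j hj x y hx hx' hy hy' heq
    have h1 := hpos i hi x hx hx'
    have h2 := hpos j hj y hy hy'
    have h3 := hp.getVert_injOn (by simp only [Set.mem_ofPred_eq]; omega)
      (by simp only [Set.mem_ofPred_eq]; omega) heq
    rcases lt_trichotomy i j with hij | rfl | hij
    · have := hlt i j hij; omega
    · exact ⟨rfl, by omega⟩
    · have := hlt j i hij; omega
  · intro i hi x hx hx'
    have h1 := hpos i hi x hx hx'.le
    have := p.adj_getVert_succ (i := ((2 * K + 1) * (i : ℤ) + K + x).toNat) (by omega)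
    rwa [show ((2 * K + 1) * (i : ℤ) + K + x).toNat + 1 =
      ((2 * K + 1) * (i : ℤ) + K + (x + 1)).toNat by omega] at this

end DisjointPaths

/-! ### Assembly -/

theorem hasBoundedTreedepth_of_isContained_apexPattern {W : Type*} [Finite W] {F : SimpleGraph W}
    {e : ℕ} (he : 1 ≤ e) (hF : F.IsContained (apexPattern e)) :
    HasBoundedTreedepth (fun _ G => F.Free G ∧ G.ediam ≤ 2) := by
  obtain ⟨f⟩ := hF
  -- As `F` is finite, its copy uses only a finite box of the infinite pattern.
  obtain ⟨r, L, hr, hL, hbox⟩ : ∃ r L : ℕ, 1 ≤ r ∧ 2 * e + 2 ≤ L ∧ ∀ w, f w ∈ apexBox r L := by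
    obtain ⟨m, hm⟩ := (Set.finite_range fun w =>
      (f w).elim 0 fun a => a.1 + a.2.natAbs).bddAbove
    refine ⟨m + 1, m + 2 * e + 2, by omega, by omega, fun w => ?_⟩
    have := hm (Set.mem_range_self w)
    cases hw : f w with
    | none => simp [apexBox]
    | some a =>
      obtain ⟨j, x⟩ := a
      simp only [hw, Option.elim] at this
      rw [some_mem_apexBox]
      omega
  set M := (4 * e + 6 + (apexBox r L).card) *
      (6 * ((4 * e + 6 + (apexBox r L).card) * 4 + r + 5)) + 1 with hM
  set K := L + 4 * e + 4 with hK
  refine ⟨(2 * K + 1) * M, fun V _ G ⟨hfree, hdiam⟩ => ?_⟩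
  refine treedepth_le_of_isPath_length_lt _ fun u v p hp => ?_
  by_contra hlen
  push Not at hlen
  refine hfree (ContainsOn.isContained ?_ f hbox)
  exact (disjointPaths_of_isPath hp hlen).containsOn_apexBox hdiam he hr hL le_rfl
    (by rw [Finset.card_range]; omega)

end SimpleGraph

theorem mainTheorem5 {W : Type*} [Finite W] (F : SimpleGraph W) (hF : F.HasExactlyOneCycle) :
    SimpleGraph.HasBoundedTreedepth (fun _ G => F.Free G ∧ G.ediam ≤ 2) ↔
      F.IsBipartite ∧ (SimpleGraph.cycleGraph 4).Free F ∧
        ∃ n : ℕ, F.IsContained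
          (SimpleGraph.joinGraph (SimpleGraph.pathGraph n) (⊤ : SimpleGraph (Fin 1))) := by
  constructor
  · intro h
    exact ⟨SimpleGraph.isBipartite_of_hasBoundedTreedepth h,
      SimpleGraph.cycleGraph_four_free_of_hasBoundedTreedepth h,
      SimpleGraph.isContained_joinGraph_of_hasBoundedTreedepth h⟩
  · rintro ⟨hbip, hC4, n, hn⟩
    obtain ⟨e, he, hcont⟩ := SimpleGraph.exists_isContained_apexPattern hF hbip hC4 hn
    exact SimpleGraph.hasBoundedTreedepth_of_isContained_apexPattern he hcont
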